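/- Let $p\in[1,\infty)$. A metric measure space $(X,d,\mathfrak m)$ is a separable (not necessarily complete) metric space with a nonzero Radon measure that is finite on bounded sets; it is doubling with constant $C_D\ge 1$ if $\mathfrak m(B_{2r}(x))\le C_D\,\mathfrak m(B_r(x))$ for all $x\in X$, $r>0$, where $B_r(x)$ is the open ball. For $u\colon X\to\mathbb R$ let $\operatorname{lip}u(x)=\lim_{\varepsilon\to0}\sup_{y\in B_\varepsilon(x)\setminus\{x\}}\frac{|u(y)-u(x)|}{d(x,y)}$ (with $\sup\emptyset=0$). For $\varepsilon>0$, a Borel function $g\colon X\to[0,\infty]$ is an $\varepsilon$-upper gradient of $u$ if $$|u(q_N)-u(q_0)|\le\sum_{i=0}^{N-1}\frac{g(q_i)+g(q_{i+1})}{2}\,d(q_i,q_{i+1})$$ for every finite sequence $q_0,\dots,q_N$ in $X$ with $d(q_i,q_{i+1})\le\varepsilon$ for all $i<N$. A point $x$ is a Lebesgue point of a Borel function $u$ if $u$ is integrable on $B_r(x)$ for all small $r>0$ and $u(x)=\lim_{r\to0}\frac1{\mathfrak m(B_r(x))}\int_{B_r(x)}u\,d\mathfrak m$. For $x,y\in X$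 and $L\ge1$ let $\mathfrak m_{x,y}^L=R_{x,y}^L\,\mathfrak m$, where $$R_{x,y}^L(z)=\frac{d(x,z)}{\mathfrak m(B_{d(x,z)}(x))}+\frac{d(y,z)}{\mathfrak m(B_{d(y,z)}(y))}$$ if $z\in \big(B_{L d(x,y)}(x)\cup B_{L d(x,y)}(y)\big)\setminus\{x,y\}$, and $R_{x,y}^L(z)=0$ otherwise. Consider the following properties of a doubling metric measure space $(X,d,\mathfrak m)$. (i) There exist $C,\lambda\ge1$ such that for every Lipschitz $u\colon X\to\mathbb R$, every $x\in X$ and every $r>0$, $$\frac1{\mathfrak m(B)}\int_{B}|u-u_B|\,d\mathfrak m\le C r\Big(\frac1{\mathfrak m(B_{\lambda r}(x))}\int_{B_{\lambda r}(x)}(\operatorname{lip}u)^p\,d\mathfrak m\Big)^{1/p},\qquad B=B_r(x),\quad u_B=\frac1{\mathfrak m(B)}\int_B u\,d\mathfrak m.$$ (ii) There exist $C>0$ and $L\ge1$ such that for every Borel $u\colon X\to\mathbb R$, all Lebesgue points $x,y$ of $u$, every $\varepsilon>0$ and every $\varepsilon$-upper gradient $g$ of $u$, $$|u(x)-u(y)|^p\le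 C\,d(x,y)^{p-1}\int g^p\,d\mathfrak m_{x,y}^L.$$ (iii) There exist $C>0$ and $L\ge1$ such that for every Lipschitz $u\colon X\to\mathbb R$ and all $x,y\in X$, $$|u(x)-u(y)|^p\le C\,d(x,y)^{p-1}\int(\operatorname{lip}u)^p\,d\mathfrak m_{x,y}^L.$$ Then (i), (ii) and (iii) are quantitatively equivalent: each implies each of the others, and the two constants in the implied property can be chosen depending only on $p$, $C_D$ and the two constants in the assumed property (and not on the space). -/

import Mathlib

open MeasureTheory Filter Topology Metric
open scoped NNReal ENNReal

universe u

noncomputable section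

namespace ChainPI

variable {X : Type u} [MetricSpace X]

/-- The slope of `f` at scale `ε`: the supremum of the difference quotients at `x` over the points
`y ≠ x` of the open ball of radius `ε` (equal to `0` if there are none). -/
def slope (f : X → ℝ) (ε : ℝ) (x : X) : ℝ≥0∞ :=
  ⨆ y ∈ ball x ε \ {x}, ENNReal.ofReal (|f y - f x| / dist y x)

/-- The local Lipschitz constant `lip f`, the limit (that is, the infimum) of the slopes as the
scale tends to `0`. -/
def lip (f : X → ℝ) (x : X) : ℝ≥0∞ :=
  ⨅ ε ∈ Set.Ioi (0 : ℝ), slope f ε x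

/-- `q 0, …, q N` is an `ε`-chain. (The values of `q` after `N` play no role.) -/
def IsEpsChain (ε : ℝ) (N : ℕ) (q : ℕ → X) : Prop :=
  ∀ i < N, dist (q i) (q (i + 1)) ≤ ε

/-- The integral of `g` over the chain `q 0, …, q N`. -/
def chainIntegral (g : X → ℝ≥0∞) (N : ℕ) (q : ℕ → X) : ℝ≥0∞ :=
  ∑ i ∈ Finset.range N, (g (q i) + g (q (i + 1))) / 2 * edist (q i) (q (i + 1))

variable [MeasurableSpace X]

/-- The Borel function `g : X → [0, ∞]` is an `ε`-upper gradient of `f`. -/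
def IsEpsUpperGradient (ε : ℝ) (f : X → ℝ) (g : X → ℝ≥0∞) : Prop :=
  Measurable g ∧ ∀ (N : ℕ) (q : ℕ → X), IsEpsChain ε N q →
    ENNReal.ofReal |f (q N) - f (q 0)| ≤ chainIntegral g N q

/-- The standing assumptions on a metric measure space: the metric space is separable (not
necessarily complete), the Borel measure `m` is nonzero, Radon, and finite on bounded sets. -/
structure IsMetricMeasureSpace [BorelSpace X] (m : Measure X) : Prop where
  separable : TopologicalSpace.SeparableSpace X
  radon : m.Regular
  nontrivial : m ≠ 0
  finite_of_bounded : ∀ s : Set X, Bornology.IsBounded s → m s < ∞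

/-- The measure `m` is doubling with constant `CD`. -/
def IsDoubling (m : Measure X) (CD : ℝ≥0) : Prop :=
  ∀ (x : X) (r : ℝ), 0 < r → m (ball x (2 * r)) ≤ CD * m (ball x r)

/-- The couple `(f, g)` satisfies the `p`-Poincaré inequality with constants `C` and `Λ`.
It is used for functions `f` that are integrable on balls. -/
def PoincareFor (m : Measure X) (p : ℝ) (C : ℝ≥0) (Λ : ℝ) (f : X → ℝ) (g : X → ℝ≥0∞) : Prop :=
  ∀ (x : X) (r : ℝ), 0 < r →
    ⨍⁻ y in ball x r, ENNReal.ofReal |f y - ⨍ z in ball x r, f z ∂m| ∂m ≤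
      C * ENNReal.ofReal r * (⨍⁻ y in ball x (Λ * r), g y ^ p ∂m) ^ (1 / p)

/-- `x` is a Lebesgue point of `f`: the averages of `f` over the balls centred at `x` are
defined for all small radii and tend to `f x`. -/
def IsLebesguePoint (m : Measure X) (f : X → ℝ) (x : X) : Prop :=
  (∀ᶠ r in 𝓝[>] (0 : ℝ), IntegrableOn f (ball x r) m) ∧
    Tendsto (fun r : ℝ => ⨍ y in ball x r, f y ∂m) (𝓝[>] 0) (𝓝 (f x))

open Classical in
/-- The `L`-truncated Riesz potential with poles `x` and `y`; it vanishes at the poles. -/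
def riesz (m : Measure X) (L : ℝ) (x y z : X) : ℝ≥0∞ :=
  if z ≠ x ∧ z ≠ y ∧ z ∈ ball x (L * dist x y) ∪ ball y (L * dist x y) then
    edist x z / m (ball x (dist x z)) + edist y z / m (ball y (dist y z))
  else 0

/-- The measure with density `riesz m L x y` with respect to `m`. -/
def rieszMeasure (m : Measure X) (L : ℝ) (x y : X) : Measure X :=
  m.withDensity (riesz m L x y)

/-- The pointwise estimate at `x, y` for the couple `(f, g)`, with constants `C` and `L`. -/
def PointwiseEstimate (m : Measure X) (p : ℝ) (C : ℝ≥0) (L : ℝ) (f : X → ℝ) (g : X → ℝ≥0∞)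
    (x y : X) : Prop :=
  ENNReal.ofReal |f x - f y| ^ p ≤
    C * edist x y ^ (p - 1) * ∫⁻ z, g z ^ p ∂(rieszMeasure m L x y)

/-- The `p`-Poincaré inequality for all couples `(f, lip f)`, `f` Lipschitz, with uniform
constants. -/
def LipPoincare (m : Measure X) (p : ℝ) (C : ℝ≥0) (Λ : ℝ) : Prop :=
  ∀ f : X → ℝ, (∃ K : ℝ≥0, LipschitzWith K f) → PoincareFor m p C Λ f (lip f)

/-- The pointwise estimate at Lebesgue points of all Borel functions, for all their
`ε`-upper gradients, `ε > 0`. -/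
def ChainPointwise (m : Measure X) (p : ℝ) (C : ℝ≥0) (L : ℝ) : Prop :=
  ∀ f : X → ℝ, Measurable f → ∀ x y : X, IsLebesguePoint m f x → IsLebesguePoint m f y →
    ∀ ε : ℝ, 0 < ε → ∀ g : X → ℝ≥0∞, IsEpsUpperGradient ε f g →
      PointwiseEstimate m p C L f g x y

/-- The pointwise estimate at all points for all couples `(f, lip f)`, `f` Lipschitz. -/
def LipPointwise (m : Measure X) (p : ℝ) (C : ℝ≥0) (L : ℝ) : Prop :=
  ∀ f : X → ℝ, (∃ K : ℝ≥0, LipschitzWith K f) → ∀ x y : X,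
    PointwiseEstimate m p C L f (lip f) x y

end ChainPI

end

set_option linter.unusedSectionVars false

/-! The implications are proved in the cycle (i) ⇒ (ii) ⇒ (iii) ⇒ (i). For (ii) ⇒ (iii), slopes of a
Lipschitz function at scales larger than `ε` are `ε`-upper gradients and decrease to `lip f`; since
the Riesz measure is finite, the limit passes under the integral. For (iii) ⇒ (i), the estimate for
pairs is averaged over a ball, and Fubini with the almost symmetric kernel turns averaged potentials
into a plain average (`setLIntegral_potential_le`).

The substance is (i) ⇒ (ii). Applied to a truncated `δ`-chain distance, a Lipschitz function with
`lip ≤ 1`, the Poincaré inequality bounds the chain distance by a multiple of the distance that does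
not depend on `δ` (`LipPoincare.chainDist_le`). Hence there are almost minimizing chains from `x` to
`y`. Give each vertex a ball of radius proportional to its distance from the nearer pole. Averages
of `f` telescope along the chain, each jump costing a local average of `lip f`
(`LipPoincare.edist_average_le_sum`). Near-minimality limits the length of chain whose balls contain
a given `z` to the order of the distance from `z` to the nearer pole (`sum_indicator_ball_le`), so
the sum of local averages is at most an integral against the Riesz kernel. With Hölder's inequality
this settles Lipschitz functions that are constant near both poles (`LipPointwise`-type estimate
`LipPoincare.pointwiseEstimate_of_eqOn_ball`).

A Borel function `u` with an `ε`-upper gradient is reduced to that case in two moves. Near each pole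
it is replaced by its average over an annulus, which changes the pole values arbitrarily little at
Lebesgue points and multiplies the energy by a constant (`exists_flattening`). Then it is truncated
and extended as a Lipschitz function from a sublevel set of its gradient `G`; at density points the
extension satisfies `lip f ≤ 2 * G` (`ae_lip_le_of_isLocalGradient`). -/

namespace ChainPI

/-! ### Doubling and the Riesz kernel -/

section MetricMeasure

variable {X : Type u} [MetricSpace X] [MeasurableSpace X]

/-- The Riesz kernel with pole `x`. -/
noncomputable def kernel (m : Measure X) (x z : X) : ℝ≥0∞ :=
  edist x z / m (ball x (dist x z))

theorem inv_le_mul_inv {a b C : ℝ≥0∞} (h : b ≤ C * a) (hC0 : C ≠ 0) (hC : C ≠ ⊤) :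
    a⁻¹ ≤ C * b⁻¹ := by
  have h1 : b / C ≤ a := ENNReal.div_le_of_le_mul (by rwa [mul_comm])
  calc a⁻¹ ≤ (b / C)⁻¹ := ENNReal.inv_le_inv.2 h1
    _ = C * b⁻¹ := by rw [ENNReal.inv_div (Or.inl hC) (Or.inl hC0), div_eq_mul_inv]

variable [BorelSpace X] {m : Measure X} {CD : ℝ≥0}

theorem IsMetricMeasureSpace.secondCountableTopology (hm : IsMetricMeasureSpace m) :
    SecondCountableTopology X :=
  haveI := hm.separable
  UniformSpace.secondCountable_of_separable X

theorem IsMetricMeasureSpace.measure_ball_lt_top (hm : IsMetricMeasureSpace m) (x : X) (r : ℝ) :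
    m (ball x r) < ⊤ :=
  hm.finite_of_bounded _ isBounded_ball

theorem IsMetricMeasureSpace.isLocallyFiniteMeasure (hm : IsMetricMeasureSpace m) :
    IsLocallyFiniteMeasure m :=
  ⟨fun x => ⟨ball x 1, ball_mem_nhds x one_pos, hm.measure_ball_lt_top x 1⟩⟩

theorem IsMetricMeasureSpace.sigmaFinite (hm : IsMetricMeasureSpace m) : SigmaFinite m :=
  haveI := hm.secondCountableTopology
  haveI := hm.isLocallyFiniteMeasure
  inferInstance

theorem IsDoubling.measure_ball_pow_le (hd : IsDoubling m CD) (x : X) {r : ℝ} (hr : 0 < r)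
    (n : ℕ) : m (ball x (2 ^ n * r)) ≤ CD ^ n * m (ball x r) := by
  induction n with
  | zero => simp
  | succ n ih =>
    calc m (ball x (2 ^ (n + 1) * r)) = m (ball x (2 * (2 ^ n * r))) := by congr 2; ring
      _ ≤ CD * m (ball x (2 ^ n * r)) := hd _ _ (by positivity)
      _ ≤ CD * (CD ^ n * m (ball x r)) := by gcongr
      _ = CD ^ (n + 1) * m (ball x r) := by rw [pow_succ]; ring

theorem IsDoubling.measure_ball_le (hd : IsDoubling m CD) {x y : X} {r s : ℝ} (hr : 0 < r)
    (n : ℕ) (h : dist y x + s ≤ 2 ^ n * r) : m (ball y s) ≤ CD ^ n * m (ball x r) :=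
  (measure_mono (ball_subset_ball' (by linarith))).trans (hd.measure_ball_pow_le x hr n)

/-- If one ball were null, so would be its dilates by powers of two, which cover the space. -/
theorem IsDoubling.measure_ball_pos (hd : IsDoubling m CD) (hm : IsMetricMeasureSpace m) (x : X)
    {r : ℝ} (hr : 0 < r) : 0 < m (ball x r) := by
  rw [pos_iff_ne_zero]
  intro h0
  apply hm.nontrivial
  rw [← Measure.measure_univ_eq_zero]
  have hU : (Set.univ : Set X) ⊆ ⋃ n : ℕ, ball x (2 ^ n * r) := by
    intro z _
    obtain ⟨n, hn⟩ := pow_unbounded_of_one_lt (dist z x / r) (one_lt_two)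
    rw [Set.mem_iUnion]
    exact ⟨n, by rw [mem_ball]; rwa [div_lt_iff₀ hr] at hn⟩
  refine measure_mono_null hU (measure_iUnion_null fun n => ?_)
  have := hd.measure_ball_pow_le x hr n
  rw [h0, mul_zero] at this
  exact le_antisymm this zero_le

/-- The denominator is the measure of a section of an open subset of `(X × X) × X`. Joint
measurability is needed for Fubini. -/
theorem measurable_kernel_uncurry (hm : IsMetricMeasureSpace m) :
    Measurable (fun q : X × X => kernel m q.1 q.2) := by
  have := hm.secondCountableTopology
  have := hm.sigmaFinite
  refine Measurable.div measurable_edist ?_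
  have hs : MeasurableSet {t : (X × X) × X | dist t.2 t.1.1 < dist t.1.1 t.1.2} := by
    apply IsOpen.measurableSet
    exact isOpen_lt (by fun_prop) (by fun_prop)
  exact measurable_measure_prodMk_left (ν := m) hs

theorem measurable_kernel (hm : IsMetricMeasureSpace m) (x : X) : Measurable (kernel m x) :=
  (measurable_kernel_uncurry hm).comp measurable_prodMk_left

@[simp] theorem kernel_self (x : X) : kernel m x x = 0 := by simp [kernel]

theorem kernel_swap_le (hd : IsDoubling m CD) (hCD : 1 ≤ CD) (x z : X) :
    kernel m x z ≤ CD * kernel m z x := by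
  rcases eq_or_ne x z with rfl | hxz
  · simp
  have hpos : 0 < dist x z := dist_pos.2 hxz
  have h1 : m (ball z (dist z x)) ≤ CD * m (ball x (dist x z)) := by
    simpa using hd.measure_ball_le (x := x) (y := z) (s := dist z x) hpos 1
      (by rw [dist_comm z x]; linarith)
  have h2 := inv_le_mul_inv h1 (by positivity) ENNReal.coe_ne_top
  simp only [kernel, div_eq_mul_inv]
  calc edist x z * (m (ball x (dist x z)))⁻¹
      ≤ edist x z * (CD * (m (ball z (dist z x)))⁻¹) := by gcongr
    _ = _ := by rw [edist_comm]; ring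

theorem kernel_le_of_comparable (hd : IsDoubling m CD) (hCD : 1 ≤ CD) {x z w : X}
    (h1 : dist x z ≤ 2 * dist x w) (h2 : dist x w ≤ 2 * dist x z) :
    kernel m x z ≤ 2 * CD * kernel m x w := by
  rcases eq_or_ne x z with rfl | hxz
  · simp
  have hpos : 0 < dist x z := dist_pos.2 hxz
  have h3 : m (ball x (dist x w)) ≤ CD * m (ball x (dist x z)) := by
    simpa using hd.measure_ball_le (x := x) (y := x) (s := dist x w) hpos 1 (by simpa using h2)
  have h4 := inv_le_mul_inv h3 (by positivity) ENNReal.coe_ne_top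
  have h5 : edist x z ≤ 2 * edist x w := by
    rw [edist_dist, edist_dist, ← ENNReal.ofReal_ofNat, ← ENNReal.ofReal_mul (by norm_num)]
    exact ENNReal.ofReal_le_ofReal h1
  simp only [kernel, div_eq_mul_inv]
  calc edist x z * (m (ball x (dist x z)))⁻¹
      ≤ (2 * edist x w) * (CD * (m (ball x (dist x w)))⁻¹) := by gcongr
    _ = _ := by ring

/-- On each dyadic annulus doubling bounds the integral by `CD` times the outer radius, and these
radii sum geometrically. -/
theorem lintegral_kernel_le (hm : IsMetricMeasureSpace m) (hd : IsDoubling m CD) (x : X) {R : ℝ}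
    (hR : 0 < R) : ∫⁻ z in ball x R, kernel m x z ∂m ≤ 2 * CD * ENNReal.ofReal R := by
  have hpt : ∀ z ∈ ball x R, kernel m x z ≤ ∑' n : ℕ, (ball x (R * (1 / 2) ^ n)).indicator
      (fun _ => ENNReal.ofReal (R * (1 / 2) ^ n) / m (ball x (R * (1 / 2) ^ (n + 1)))) z := by
    intro z hz
    rcases eq_or_ne x z with rfl | hxz
    · simp
    have hpos : 0 < dist x z := dist_pos.2 hxz
    rw [mem_ball'] at hz
    obtain ⟨n, hn1, hn2⟩ := exists_nat_pow_near_of_lt_one (x := dist x z / R) (y := (1 / 2 : ℝ))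
      (by positivity) (by rw [div_le_one hR]; exact hz.le) (by norm_num) (by norm_num)
    rw [lt_div_iff₀ hR] at hn1
    rw [div_le_iff₀ hR] at hn2
    rcases n with _ | n
    · refine le_trans ?_ (ENNReal.le_tsum 0)
      rw [Set.indicator_of_mem (by rw [mem_ball']; simpa using hz)]
      unfold kernel
      rw [edist_dist]
      gcongr
      · linarith
      · linarith
    rcases hn2.lt_or_eq with hlt | heq
    · refine le_trans ?_ (ENNReal.le_tsum (n + 1))
      rw [Set.indicator_of_mem (by rw [mem_ball']; linarith)]
      unfold kernel
      rw [edist_dist]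
      gcongr
      · linarith
      · linarith
    -- A point on a dyadic sphere is outside the open ball of that radius, so the next larger ball
    -- serves.
    · refine le_trans ?_ (ENNReal.le_tsum n)
      have : dist x z < R * (1 / 2) ^ n := by
        rw [heq, pow_succ]
        have : 0 < R * (1 / 2) ^ n := by positivity
        linarith
      rw [Set.indicator_of_mem (by rwa [mem_ball'])]
      unfold kernel
      rw [edist_dist]
      gcongr
      linarith
  calc ∫⁻ z in ball x R, kernel m x z ∂m
      ≤ ∫⁻ z in ball x R, (∑' n : ℕ, (ball x (R * (1 / 2) ^ n)).indicator
      (fun _ => ENNReal.ofReal (R * (1 / 2) ^ n) / m (ball x (R * (1 / 2) ^ (n + 1)))) z) ∂m :=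
        setLIntegral_mono' measurableSet_ball hpt
    _ ≤ ∫⁻ z, (∑' n : ℕ, (ball x (R * (1 / 2) ^ n)).indicator
      (fun _ => ENNReal.ofReal (R * (1 / 2) ^ n) / m (ball x (R * (1 / 2) ^ (n + 1)))) z) ∂m :=
        setLIntegral_le_lintegral _ _
    _ = ∑' n : ℕ, ENNReal.ofReal (R * (1 / 2) ^ n) / m (ball x (R * (1 / 2) ^ (n + 1))) *
          m (ball x (R * (1 / 2) ^ n)) := by
        rw [lintegral_tsum fun n => (measurable_const.indicator measurableSet_ball).aemeasurable]
        simp [lintegral_indicator_const measurableSet_ball]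
    _ ≤ ∑' n : ℕ, ENNReal.ofReal (R * (1 / 2) ^ n) * CD := by
        refine ENNReal.tsum_le_tsum fun n => ?_
        have hr : 0 < R * (1 / 2) ^ (n + 1) := by positivity
        have h := hd x _ hr
        have e : 2 * (R * (1 / 2) ^ (n + 1)) = R * (1 / 2) ^ n := by rw [pow_succ]; ring
        rw [e] at h
        calc _ ≤ ENNReal.ofReal (R * (1 / 2) ^ n) / m (ball x (R * (1 / 2) ^ (n + 1))) *
              (CD * m (ball x (R * (1 / 2) ^ (n + 1)))) := by gcongr
          _ = ENNReal.ofReal (R * (1 / 2) ^ n) * CD *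
              (m (ball x (R * (1 / 2) ^ (n + 1))) / m (ball x (R * (1 / 2) ^ (n + 1)))) := by
              simp only [div_eq_mul_inv]; ring
          _ = _ := by
              rw [ENNReal.div_self (hd.measure_ball_pos hm x hr).ne'
                (hm.measure_ball_lt_top x _).ne, mul_one]
    _ = 2 * CD * ENNReal.ofReal R := by
        rw [ENNReal.tsum_mul_right]
        have : ∀ n : ℕ, ENNReal.ofReal (R * (1 / 2) ^ n) = ENNReal.ofReal R * 2⁻¹ ^ n := by
          intro n
          rw [ENNReal.ofReal_mul hR.le, ENNReal.ofReal_pow (by norm_num)]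
          congr 2
          rw [one_div, ENNReal.ofReal_inv_of_pos (by norm_num), ENNReal.ofReal_ofNat]
        simp_rw [this]
        rw [ENNReal.tsum_mul_left, ENNReal.tsum_geometric, ENNReal.one_sub_inv_two, inv_inv]
        ring

theorem riesz_eq {L : ℝ} {x y z : X} (hx : z ≠ x) (hy : z ≠ y)
    (h : z ∈ ball x (L * dist x y) ∪ ball y (L * dist x y)) :
    riesz m L x y z = kernel m x z + kernel m y z := by
  rw [riesz, if_pos ⟨hx, hy, h⟩]; rfl

theorem riesz_comm (L : ℝ) (x y : X) : riesz m L x y = riesz m L y x := by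
  classical
  ext z
  have h : (z ≠ x ∧ z ≠ y ∧ z ∈ ball x (L * dist x y) ∪ ball y (L * dist x y)) ↔
      (z ≠ y ∧ z ≠ x ∧ z ∈ ball y (L * dist y x) ∪ ball x (L * dist y x)) := by
    rw [dist_comm x y, Set.union_comm]
    tauto
  simp only [riesz]
  rw [if_congr h (add_comm _ _) rfl]

theorem riesz_le_indicator (L : ℝ) (x y z : X) :
    riesz m L x y z ≤ (ball x (L * dist x y) ∪ ball y (L * dist x y)).indicator
      (fun z => kernel m x z + kernel m y z) z := by
  unfold riesz
  split_ifs with h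
  · rw [Set.indicator_of_mem h.2.2]; rfl
  · exact bot_le

theorem measurable_riesz (hm : IsMetricMeasureSpace m) (L : ℝ) (x y : X) :
    Measurable (riesz m L x y) := by
  refine Measurable.ite ?_ ((measurable_kernel hm x).add (measurable_kernel hm y)) measurable_const
  exact ((measurableSet_singleton x).compl).inter (((measurableSet_singleton y).compl).inter
    (measurableSet_ball.union measurableSet_ball))

theorem lintegral_rieszMeasure (hm : IsMetricMeasureSpace m) (L : ℝ) (x y : X) {g : X → ℝ≥0∞}
    (hg : Measurable g) :
    ∫⁻ z, g z ∂(rieszMeasure m L x y) = ∫⁻ z, riesz m L x y z * g z ∂m := by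
  rw [rieszMeasure, lintegral_withDensity_eq_lintegral_mul _ (measurable_riesz hm L x y) hg]
  rfl

theorem rieszMeasure_comm (L : ℝ) (x y : X) : rieszMeasure m L x y = rieszMeasure m L y x := by
  rw [rieszMeasure, riesz_comm, rieszMeasure]

/-- Needed to pass to a decreasing limit under the integral in `ChainPointwise.lipPointwise`. -/
theorem lintegral_riesz_lt_top (hm : IsMetricMeasureSpace m) (hd : IsDoubling m CD) (L : ℝ)
    (x y : X) : ∫⁻ z, riesz m L x y z ∂m < ⊤ := by
  set R := |L| * dist x y + dist x y + 1
  have hR : 0 < R := by positivity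
  have hLR : L * dist x y ≤ |L| * dist x y := by gcongr; exact le_abs_self L
  have hk : ∀ w ∈ ({x, y} : Set X), ball x (L * dist x y) ∪ ball y (L * dist x y) ⊆ ball w R := by
    intro w hw
    have h1 : dist x w ≤ dist x y ∧ dist y w ≤ dist x y := by
      rcases hw with rfl | rfl
      · exact ⟨by simp, by rw [dist_comm]⟩
      · exact ⟨le_rfl, by simp⟩
    refine Set.union_subset (ball_subset_ball' ?_) (ball_subset_ball' ?_)
    · linarith [h1.1]
    · linarith [h1.2]
  calc ∫⁻ z, riesz m L x y z ∂m
      ≤ ∫⁻ z, (ball x R).indicator (kernel m x) z + (ball y R).indicator (kernel m y) z ∂m := by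
        refine lintegral_mono fun z => (riesz_le_indicator L x y z).trans ?_
        by_cases hz : z ∈ ball x (L * dist x y) ∪ ball y (L * dist x y)
        · rw [Set.indicator_of_mem hz, Set.indicator_of_mem (hk x (by simp) hz),
            Set.indicator_of_mem (hk y (by simp) hz)]
        · rw [Set.indicator_of_notMem hz]
          exact bot_le
    _ = (∫⁻ z in ball x R, kernel m x z ∂m) + ∫⁻ z in ball y R, kernel m y z ∂m := by
        rw [lintegral_add_left ((measurable_kernel hm x).indicator measurableSet_ball),
          lintegral_indicator measurableSet_ball, lintegral_indicator measurableSet_ball]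
    _ < ⊤ := by
        refine ENNReal.add_lt_top.2 ⟨?_, ?_⟩
        · exact (lintegral_kernel_le hm hd x hR).trans_lt (by finiteness)
        · exact (lintegral_kernel_le hm hd y hR).trans_lt (by finiteness)

end MetricMeasure

/-! ### Slopes, upper gradients, and (ii) ⇒ (iii) -/

section Slope

variable {X : Type u} [MetricSpace X]

theorem ofReal_abs_sub_eq_edist (a b : ℝ) : ENNReal.ofReal |a - b| = edist a b := by
  rw [edist_dist, Real.dist_eq]

theorem slope_mono (f : X → ℝ) {ε ε' : ℝ} (h : ε ≤ ε') (x : X) : slope f ε x ≤ slope f ε' x :=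
  biSup_mono fun _ hy => ⟨ball_subset_ball h hy.1, hy.2⟩

theorem edist_le_slope_mul (f : X → ℝ) {ε : ℝ} {x y : X} (hy : dist y x < ε) :
    edist (f y) (f x) ≤ slope f ε x * edist y x := by
  rcases eq_or_ne y x with rfl | hyx
  · simp
  have h : ENNReal.ofReal (|f y - f x| / dist y x) ≤ slope f ε x :=
    le_biSup (fun y => ENNReal.ofReal (|f y - f x| / dist y x))
      (show y ∈ ball x ε \ {x} from ⟨hy, hyx⟩)
  calc edist (f y) (f x) = ENNReal.ofReal (|f y - f x| / dist y x * dist y x) := by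
        rw [div_mul_cancel₀ _ (dist_pos.2 hyx).ne', ofReal_abs_sub_eq_edist]
    _ = ENNReal.ofReal (|f y - f x| / dist y x) * edist y x := by
        rw [ENNReal.ofReal_mul (by positivity), edist_dist]
    _ ≤ _ := by gcongr

theorem slope_le {f : X → ℝ} {ε : ℝ} {x : X} {c : ℝ≥0∞}
    (h : ∀ y, dist y x < ε → edist (f y) (f x) ≤ c * edist y x) : slope f ε x ≤ c := by
  refine iSup₂_le fun y hy => ?_
  have hpos : 0 < dist y x := dist_pos.2 hy.2
  rw [ENNReal.ofReal_div_of_pos hpos, ofReal_abs_sub_eq_edist, ← edist_dist]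
  exact ENNReal.div_le_of_le_mul (h y hy.1)

theorem lip_le_slope (f : X → ℝ) {ε : ℝ} (hε : 0 < ε) (x : X) : lip f x ≤ slope f ε x :=
  iInf₂_le ε hε

theorem lip_eq_iInf_nat (f : X → ℝ) (x : X) : lip f x = ⨅ n : ℕ, slope f (1 / (n + 1)) x := by
  refine le_antisymm (le_iInf fun n => lip_le_slope f (by positivity) x) ?_
  refine le_iInf₂ fun ε hε => ?_
  obtain ⟨n, hn⟩ := exists_nat_one_div_lt (Set.mem_Ioi.1 hε)
  exact (iInf_le _ n).trans (slope_mono f hn.le x)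

theorem lip_eq_zero_of_eqOn_ball {f : X → ℝ} {x z : X} {r : ℝ} (hz : z ∈ ball x r)
    (h : ∀ w ∈ ball x r, f w = f x) : lip f z = 0 := by
  obtain ⟨ε, hε, hsub⟩ := Metric.isOpen_iff.1 isOpen_ball z hz
  refine le_antisymm ((lip_le_slope f hε z).trans (slope_le fun y hy => ?_)) bot_le
  rw [h y (hsub hy), h z hz]
  simp

theorem slope_le_of_lipschitzWith {f : X → ℝ} {K : ℝ≥0} (hf : LipschitzWith K f) (ε : ℝ) (x : X) :
    slope f ε x ≤ K :=
  slope_le fun y _ => hf y x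

theorem lip_le_of_lipschitzWith {f : X → ℝ} {K : ℝ≥0} (hf : LipschitzWith K f) (x : X) :
    lip f x ≤ K :=
  (lip_le_slope f one_pos x).trans (slope_le_of_lipschitzWith hf 1 x)

variable [MeasurableSpace X] [BorelSpace X]

/-- The slope is lower semicontinuous: for fixed `y` the difference quotient is continuous in `x ≠
y`, and the condition `dist y x < ε` is open in `x`. -/
theorem measurable_slope {f : X → ℝ} (hf : Continuous f) (ε : ℝ) : Measurable (slope f ε) := by
  refine LowerSemicontinuous.measurable (lowerSemicontinuous_iff_isOpen_preimage.2 fun c => ?_)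
  have : slope f ε ⁻¹' Set.Ioi c = ⋃ y, ((ball y ε ∩ {y}ᶜ) ∩
      (fun x => ENNReal.ofReal (|f y - f x| / dist y x)) ⁻¹' Set.Ioi c) := by
    ext x
    simp only [slope, Set.mem_preimage, Set.mem_Ioi, lt_iSup_iff, Set.mem_iUnion, Set.mem_inter_iff,
      Set.mem_sdiff, mem_ball, Set.mem_singleton_iff, Set.mem_compl_iff]
    refine exists_congr fun y => ?_
    rw [dist_comm y x, exists_prop]
    simp only [eq_comm]
  rw [this]
  refine isOpen_iUnion fun y => ContinuousOn.isOpen_inter_preimage ?_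
    (isOpen_ball.inter isOpen_compl_singleton) isOpen_Ioi
  refine ENNReal.continuous_ofReal.comp_continuousOn (ContinuousOn.div ?_ ?_ ?_)
  · exact (continuous_const.sub hf).abs.continuousOn
  · exact (continuous_const.dist continuous_id).continuousOn
  · rintro x ⟨_, hx⟩
    exact (dist_pos.2 (Ne.symm hx)).ne'

theorem measurable_lip {f : X → ℝ} (hf : Continuous f) : Measurable (lip f) := by
  have : lip f = fun x => ⨅ n : ℕ, slope f (1 / (n + 1)) x := funext (lip_eq_iInf_nat f)
  rw [this]
  exact Measurable.iInf fun n => measurable_slope hf _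

theorem edist_le_chainIntegral {f : X → ℝ} {g : X → ℝ≥0∞} {ε : ℝ} (N : ℕ) (q : ℕ → X)
    (hq : IsEpsChain ε N q)
    (h : ∀ z w, dist z w ≤ ε → edist (f z) (f w) ≤ (g z + g w) / 2 * edist z w) :
    edist (f (q N)) (f (q 0)) ≤ chainIntegral g N q := by
  rw [edist_comm]
  exact (edist_le_range_sum_edist (fun i => f (q i)) N).trans
    (Finset.sum_le_sum fun i hi => h _ _ (hq i (Finset.mem_range.1 hi)))

/-- Each increment is bounded by the slope at either endpoint, hence by their mean. The inequality
`ε < ε'` is strict because chain steps may equal `ε` while slopes see open balls. -/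
theorem isEpsUpperGradient_slope {f : X → ℝ} (hf : Continuous f) {ε ε' : ℝ} (h : ε < ε') :
    IsEpsUpperGradient ε f (slope f ε') := by
  refine ⟨measurable_slope hf _, fun N q hq => ?_⟩
  rw [ofReal_abs_sub_eq_edist]
  refine edist_le_chainIntegral N q hq fun z w hzw => ?_
  have h1 : edist (f z) (f w) ≤ slope f ε' w * edist z w :=
    edist_le_slope_mul f (hzw.trans_lt h)
  have h2 : edist (f z) (f w) ≤ slope f ε' z * edist z w := by
    rw [edist_comm (f z), edist_comm z]
    exact edist_le_slope_mul f (by rw [dist_comm]; exact hzw.trans_lt h)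
  rw [div_eq_mul_inv, mul_right_comm, ← div_eq_mul_inv,
    ENNReal.le_div_iff_mul_le (by simp) (by simp), add_mul, mul_two]
  exact add_le_add h2 h1

/-- Besides measurability, this consequence for two-point chains is all that (i) ⇒ (ii) uses of an
upper gradient. -/
theorem IsEpsUpperGradient.edist_le {f : X → ℝ} {g : X → ℝ≥0∞} {ε : ℝ}
    (h : IsEpsUpperGradient ε f g) {z w : X} (hzw : dist z w ≤ ε) :
    edist (f z) (f w) ≤ (g z + g w) * edist z w := by
  have := h.2 1 (fun i => if i = 0 then z else w) (fun i hi => by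
    obtain rfl : i = 0 := by omega
    simpa using hzw)
  rw [ofReal_abs_sub_eq_edist] at this
  simp only [chainIntegral, Finset.range_one, Finset.sum_singleton] at this
  rw [edist_comm]
  refine (by simpa using this : edist (f w) (f z) ≤ (g z + g w) / 2 * edist z w).trans ?_
  gcongr
  exact ENNReal.div_le_of_le_mul (by rw [mul_two]; exact le_self_add)

variable {m : Measure X} {CD : ℝ≥0}

theorem IsMetricMeasureSpace.integrableOn_ball (hm : IsMetricMeasureSpace m) {f : X → ℝ} {K : ℝ≥0}
    (hf : LipschitzWith K f) (x : X) (r : ℝ) : IntegrableOn f (ball x r) m := by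
  refine Measure.integrableOn_of_bounded (M := |f x| + K * r) (hm.measure_ball_lt_top x r).ne
    (have := hm.secondCountableTopology; hf.continuous.aestronglyMeasurable) ?_
  refine (ae_restrict_iff' measurableSet_ball).2 (Eventually.of_forall fun z hz => ?_)
  have h1 := hf.dist_le_mul z x
  rw [Real.dist_eq] at h1
  have h2 : (K : ℝ) * dist z x ≤ K * r := by gcongr; exact (mem_ball.1 hz).le
  have h3 := abs_sub_abs_le_abs_sub (f z) (f x)
  rw [Real.norm_eq_abs]
  linarith

theorem abs_average_sub_le (hm : IsMetricMeasureSpace m) (hd : IsDoubling m CD) {f : X → ℝ}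
    {K : ℝ≥0} (hf : LipschitzWith K f) (x : X) {r : ℝ} (hr : 0 < r) :
    |(⨍ z in ball x r, f z ∂m) - f x| ≤ K * r := by
  have := (convex_closedBall (f x) (K * r)).set_average_mem isClosed_closedBall
    (hd.measure_ball_pos hm x hr).ne' (hm.measure_ball_lt_top x r).ne
    ((ae_restrict_iff' measurableSet_ball).2 (Eventually.of_forall fun z hz => ?_))
    (hm.integrableOn_ball hf x r)
  · rwa [mem_closedBall, Real.dist_eq] at this
  · have h2 : (K : ℝ) * dist z x ≤ K * r := by gcongr; exact (mem_ball.1 hz).le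
    exact mem_closedBall.2 ((hf.dist_le_mul z x).trans h2)

theorem isLebesguePoint_of_lipschitzWith (hm : IsMetricMeasureSpace m) (hd : IsDoubling m CD)
    {f : X → ℝ} {K : ℝ≥0} (hf : LipschitzWith K f) (x : X) : IsLebesguePoint m f x := by
  refine ⟨Eventually.of_forall fun r => hm.integrableOn_ball hf x r, ?_⟩
  rw [tendsto_iff_dist_tendsto_zero]
  have h0 : Tendsto (fun r : ℝ => (K : ℝ) * r) (𝓝[>] 0) (𝓝 0) := by
    have : Tendsto (fun r : ℝ => (K : ℝ) * r) (𝓝 0) (𝓝 (K * 0)) :=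
      (continuous_const.mul continuous_id).tendsto 0
    rw [mul_zero] at this
    exact this.mono_left nhdsWithin_le_nhds
  refine squeeze_zero' (Eventually.of_forall fun _ => dist_nonneg) ?_ h0
  filter_upwards [self_mem_nhdsWithin] with r hr
  rw [Real.dist_eq]
  exact abs_average_sub_le hm hd hf x hr

theorem ChainPointwise.lipPointwise (hm : IsMetricMeasureSpace m) (hd : IsDoubling m CD) {p : ℝ}
    (hp : 1 ≤ p) {C : ℝ≥0} {L : ℝ} (h : ChainPointwise m p C L) : LipPointwise m p C L := by
  rintro f ⟨K, hf⟩ x y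
  have hp0 : 0 < p := by linarith
  set g : ℕ → X → ℝ≥0∞ := fun n => slope f (1 / (n + 1))
  have hgm : ∀ n, Measurable (g n) := fun n => measurable_slope hf.continuous _
  have hlim : ∫⁻ z, lip f z ^ p ∂(rieszMeasure m L x y) =
      ⨅ n, ∫⁻ z, g n z ^ p ∂(rieszMeasure m L x y) := by
    rw [← lintegral_iInf (fun n => (hgm n).pow_const p)]
    · congr 1
      ext z
      rw [lip_eq_iInf_nat]
      exact (ENNReal.orderIsoRpow p hp0).map_iInf _
    · intro i j hij z
      exact ENNReal.rpow_le_rpow (slope_mono f (one_div_le_one_div_of_le (by positivity)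
        (by gcongr)) z) hp0.le
    · refine ne_of_lt (lt_of_le_of_lt (lintegral_mono (g := fun _ => (K : ℝ≥0∞) ^ p) fun z =>
        ENNReal.rpow_le_rpow (slope_le_of_lipschitzWith hf _ z) hp0.le) ?_)
      rw [lintegral_const, rieszMeasure, withDensity_apply _ MeasurableSet.univ,
        Measure.restrict_univ]
      exact ENNReal.mul_lt_top (ENNReal.rpow_lt_top_of_nonneg hp0.le ENNReal.coe_ne_top)
        (lintegral_riesz_lt_top hm hd L x y)
  unfold PointwiseEstimate
  have hfin : (C : ℝ≥0∞) * edist x y ^ (p - 1) ≠ ⊤ :=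
    ENNReal.mul_ne_top ENNReal.coe_ne_top
      (ENNReal.rpow_ne_top_of_nonneg (by linarith) (edist_ne_top x y))
  rw [hlim, ENNReal.mul_iInf fun htop => absurd htop hfin]
  refine le_iInf fun n => ?_
  exact h f hf.continuous.measurable x y (isLebesguePoint_of_lipschitzWith hm hd hf x)
    (isLebesguePoint_of_lipschitzWith hm hd hf y) (1 / (n + 1) / 2) (by positivity) (g n)
    (isEpsUpperGradient_slope hf.continuous (half_lt_self (by positivity)))

end Slope

/-! ### Averages of extended nonnegative functions -/

section Averages

variable {X : Type u} [MeasurableSpace X] {m : Measure X} {s : Set X}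

/-- Jensen's inequality, obtained from monotonicity of `L^p` norms for the normalized measure. -/
theorem laverage_rpow_le {p : ℝ} (hp : 1 ≤ p) (h0 : m s ≠ 0) (hs : m s ≠ ⊤) {φ : X → ℝ≥0∞}
    (hφ : Measurable φ) : (⨍⁻ z in s, φ z ∂m) ^ p ≤ ⨍⁻ z in s, φ z ^ p ∂m := by
  have : NeZero (m.restrict s) := ⟨fun h => h0 (by rwa [Measure.restrict_eq_zero] at h)⟩
  have : IsFiniteMeasure (m.restrict s) := ⟨by simpa using hs.lt_top⟩
  have hp0 : 0 < p := by linarith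
  have h := eLpNorm'_le_eLpNorm'_of_exponent_le one_pos hp
    (((m.restrict s) Set.univ)⁻¹ • m.restrict s) hφ.aestronglyMeasurable
  simp only [eLpNorm', enorm_eq_self, ENNReal.rpow_one, div_one] at h
  have h2 := ENNReal.rpow_le_rpow h hp0.le
  rwa [← ENNReal.rpow_mul, one_div_mul_cancel hp0.ne', ENNReal.rpow_one] at h2

theorem laverage_const_add (h0 : m s ≠ 0) (hs : m s ≠ ⊤) (c : ℝ≥0∞) (φ : X → ℝ≥0∞) :
    ⨍⁻ z in s, (c + φ z) ∂m = c + ⨍⁻ z in s, φ z ∂m := by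
  rw [setLAverage_eq, setLAverage_eq, lintegral_add_left measurable_const, setLIntegral_const,
    ENNReal.add_div, ENNReal.mul_div_cancel_right h0 hs]

theorem laverage_mono {φ ψ : X → ℝ≥0∞} (hms : MeasurableSet s) (h : ∀ z ∈ s, φ z ≤ ψ z) :
    ⨍⁻ z in s, φ z ∂m ≤ ⨍⁻ z in s, ψ z ∂m := by
  rw [setLAverage_eq, setLAverage_eq]
  gcongr 1
  exact setLIntegral_mono' hms h

theorem laverage_const_mul (c : ℝ≥0∞) (hc : c ≠ ⊤) (φ : X → ℝ≥0∞) :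
    ⨍⁻ z in s, c * φ z ∂m = c * ⨍⁻ z in s, φ z ∂m := by
  rw [setLAverage_eq, setLAverage_eq, lintegral_const_mul' _ _ hc, mul_div_assoc]

theorem edist_average_le (h0 : m s ≠ 0) (hs : m s ≠ ⊤) {f : X → ℝ} (hf : IntegrableOn f s m)
    (c : ℝ) : edist (⨍ z in s, f z ∂m) c ≤ ⨍⁻ z in s, edist (f z) c ∂m := by
  have hreal : (m.real s) ≠ 0 := (ENNReal.toReal_pos h0 hs).ne'
  have hint : ⨍ z in s, f z ∂m - c = ⨍ z in s, (f z - c) ∂m := by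
    have hc : IntegrableOn (fun _ => c) s m := integrableOn_const hs
    rw [setAverage_eq, setAverage_eq, integral_sub hf hc, setIntegral_const, smul_sub, smul_smul,
      inv_mul_cancel₀ hreal, one_smul]
  rw [edist_eq_enorm_sub, hint]
  simp only [edist_eq_enorm_sub]
  exact enorm_integral_le_lintegral_enorm _

/-- Comparison of averages over nested sets of comparable measure. -/
theorem laverage_le_of_subset {t : Set X} (hst : s ⊆ t) {K : ℝ≥0} (hK : K ≠ 0)
    (h : m t ≤ K * m s) (φ : X → ℝ≥0∞) : ⨍⁻ z in s, φ z ∂m ≤ K * ⨍⁻ z in t, φ z ∂m := by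
  rw [setLAverage_eq, setLAverage_eq, div_eq_mul_inv, div_eq_mul_inv]
  calc (∫⁻ z in s, φ z ∂m) * (m s)⁻¹ ≤ (∫⁻ z in t, φ z ∂m) * (K * (m t)⁻¹) :=
        mul_le_mul' (lintegral_mono_set hst)
          (inv_le_mul_inv h (by exact_mod_cast hK) ENNReal.coe_ne_top)
    _ = _ := by ring

/-- Since `C ≥ 1`, one has `K ≤ C ≤ C ^ p`. This is the reason for the summand `1` in the constant
of `LipPointwise.lipPoincare`. -/
theorem le_mul_rpow_of_rpow_le {p : ℝ} (hp : 1 ≤ p) {A K C r I : ℝ≥0∞}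
    (h : A ^ p ≤ K * r ^ p * I) (hK : K ≤ C) (hC : 1 ≤ C) : A ≤ C * r * I ^ (1 / p) := by
  have hp0 : 0 < p := by linarith
  rw [← ENNReal.rpow_le_rpow_iff hp0, ENNReal.mul_rpow_of_nonneg _ _ hp0.le,
    ENNReal.mul_rpow_of_nonneg _ _ hp0.le, ← ENNReal.rpow_mul, one_div_mul_cancel hp0.ne',
    ENNReal.rpow_one]
  refine h.trans ?_
  gcongr
  calc K ≤ C := hK
    _ = C ^ (1 : ℝ) := (ENNReal.rpow_one _).symm
    _ ≤ C ^ p := ENNReal.rpow_le_rpow_of_exponent_le hC hp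

end Averages

/-! ### (iii) ⇒ (i): averaging the pointwise estimate -/

section PointwiseToPoincare

variable {X : Type u} [MetricSpace X] [MeasurableSpace X] [BorelSpace X] {m : Measure X}
  {CD : ℝ≥0}

/-- After Fubini the kernel is integrated in its pole; `kernel_swap_le` moves the pole to `w`, and
`lintegral_kernel_le` applies on a ball about `w`. -/
theorem setLIntegral_potential_le (hm : IsMetricMeasureSpace m) (hd : IsDoubling m CD)
    (hCD : 1 ≤ CD) {g : X → ℝ≥0∞} (hg : Measurable g) (x₀ : X) {r R : ℝ} (hr : 0 < r)
    (hR : 0 < R) :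
    ∫⁻ x in ball x₀ r, ∫⁻ w in ball x₀ R, kernel m x w * g w ∂m ∂m ≤
      2 * CD ^ 2 * ENNReal.ofReal (R + r) * ∫⁻ w in ball x₀ R, g w ∂m := by
  have := hm.secondCountableTopology
  have := hm.sigmaFinite
  rw [lintegral_lintegral_swap, ← lintegral_const_mul _ hg]
  · refine setLIntegral_mono' measurableSet_ball fun w hw => ?_
    calc ∫⁻ x in ball x₀ r, kernel m x w * g w ∂m
        = (∫⁻ x in ball x₀ r, kernel m x w ∂m) * g w := by
          exact lintegral_mul_const _
            ((measurable_kernel_uncurry hm).comp measurable_prodMk_right)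
      _ ≤ (∫⁻ x in ball w (R + r), CD * kernel m w x ∂m) * g w := by
          refine mul_le_mul_left ?_ _
          refine (lintegral_mono_set (ball_subset_ball' ?_)).trans
            (lintegral_mono fun x => kernel_swap_le hd hCD x w)
          linarith [mem_ball'.1 hw]
      _ ≤ CD * (2 * CD * ENNReal.ofReal (R + r)) * g w := by
          rw [lintegral_const_mul _ (measurable_kernel hm w)]
          gcongr
          exact lintegral_kernel_le hm hd w (by positivity)
      _ = _ := by ring
  · exact ((measurable_kernel_uncurry hm).mul (hg.comp measurable_snd)).aemeasurable

theorem LipPointwise.lipPoincare (hm : IsMetricMeasureSpace m) (hd : IsDoubling m CD)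
    (hCD : 1 ≤ CD) {p : ℝ} (hp : 1 ≤ p) {C : ℝ≥0} {L : ℝ} (hL : 1 ≤ L)
    (h : LipPointwise m p C L) :
    LipPoincare m p (1 + C * 2 ^ (p - 1) * 4 * CD ^ (2 + ⌈2 * L + 1⌉₊) * (2 * L + 2).toNNReal)
      (2 * L + 1) := by
  rintro f ⟨K, hf⟩ x₀ r hr
  -- For `y, z` in the ball of radius `r`, the support balls of the Riesz density have radius below
  -- `2 * L * r`, so they stay inside the ball of radius `R` about `x₀`.
  set R := (2 * L + 1) * r with hRdef
  have hR : 0 < R := by positivity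
  have hp0 : 0 < p := by linarith
  set B := ball x₀ r
  have hB0 : m B ≠ 0 := (hd.measure_ball_pos hm x₀ hr).ne'
  have hBt : m B ≠ ⊤ := (hm.measure_ball_lt_top x₀ r).ne
  set g : X → ℝ≥0∞ := fun z => lip f z ^ p
  have hg : Measurable g := (measurable_lip hf.continuous).pow_const p
  set F : X → ℝ≥0∞ := fun x => ∫⁻ w in ball x₀ R, kernel m x w * g w ∂m
  have hpair : ∀ y ∈ B, ∀ z ∈ B, edist (f y) (f z) ^ p ≤
      C * (2 * ENNReal.ofReal r) ^ (p - 1) * (F y + F z) := by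
    intro y hy z hz
    have hyz : dist y z < 2 * r := by
      linarith [dist_triangle_right y z x₀, mem_ball.1 hy, mem_ball.1 hz]
    have h1 := h f ⟨K, hf⟩ y z
    rw [PointwiseEstimate, ofReal_abs_sub_eq_edist] at h1
    refine h1.trans ?_
    gcongr
    · rw [edist_dist, ← ENNReal.ofReal_ofNat, ← ENNReal.ofReal_mul (by norm_num)]
      exact ENNReal.ofReal_le_ofReal hyz.le
    · have hsum : F y + F z =
          ∫⁻ w, (ball x₀ R).indicator (fun w => kernel m y w * g w + kernel m z w * g w) w ∂m := by
        rw [lintegral_indicator measurableSet_ball]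
        exact (lintegral_add_left ((measurable_kernel hm y).mul hg) _).symm
      rw [lintegral_rieszMeasure hm L y z hg, hsum]
      refine lintegral_mono fun w => ?_
      by_cases hw : w ∈ ball y (L * dist y z) ∪ ball z (L * dist y z)
      · have hwR : w ∈ ball x₀ R := by
          have hLd : L * dist y z < L * (2 * r) := by gcongr
          refine Set.union_subset (ball_subset_ball' ?_) (ball_subset_ball' ?_) hw
          · rw [hRdef]; linarith [mem_ball.1 hy]
          · rw [hRdef]; linarith [mem_ball.1 hz]
        rw [Set.indicator_of_mem hwR, ← add_mul]
        gcongr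
        refine (riesz_le_indicator L y z w).trans ?_
        rw [Set.indicator_of_mem hw]
      · have h0 := riesz_le_indicator (m := m) L y z w
        rw [Set.indicator_of_notMem hw, nonpos_iff_eq_zero] at h0
        rw [h0, zero_mul]
        exact bot_le
  have hcfin : (C : ℝ≥0∞) * (2 * ENNReal.ofReal r) ^ (p - 1) ≠ ⊤ :=
    ENNReal.mul_ne_top ENNReal.coe_ne_top
      (ENNReal.rpow_ne_top_of_nonneg (by linarith) (by finiteness))
  set c := (C : ℝ≥0∞) * (2 * ENNReal.ofReal r) ^ (p - 1)
  have hint := hm.integrableOn_ball hf x₀ r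
  -- The pair estimate is averaged in `z` here; the average in `y` is taken at the end.
  have hpt : ∀ y ∈ B, edist (f y) (⨍ z in B, f z ∂m) ^ p ≤ c * (F y + ⨍⁻ z in B, F z ∂m) := by
    intro y hy
    calc edist (f y) (⨍ z in B, f z ∂m) ^ p ≤ (⨍⁻ z in B, edist (f z) (f y) ∂m) ^ p := by
          rw [edist_comm]
          gcongr
          exact edist_average_le hB0 hBt hint _
      _ ≤ ⨍⁻ z in B, edist (f z) (f y) ^ p ∂m :=
          laverage_rpow_le hp hB0 hBt (hf.continuous.edist continuous_const).measurable
      _ ≤ ⨍⁻ z in B, c * (F y + F z) ∂m :=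
          laverage_mono measurableSet_ball fun z hz => by
            rw [edist_comm]; exact hpair y hy z hz
      _ = _ := by rw [laverage_const_mul _ hcfin, laverage_const_add hB0 hBt]
  have hF : ⨍⁻ y in B, F y ∂m ≤ 2 * CD ^ 2 * ENNReal.ofReal (R + r) *
      (CD ^ ⌈2 * L + 1⌉₊ * ⨍⁻ w in ball x₀ R, g w ∂m) := by
    have hinv : (m B)⁻¹ ≤ CD ^ ⌈2 * L + 1⌉₊ * (m (ball x₀ R))⁻¹ := by
      refine inv_le_mul_inv ?_ (pow_ne_zero _ (by positivity))
        (ENNReal.pow_ne_top ENNReal.coe_ne_top)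
      refine hd.measure_ball_le hr _ ?_
      rw [dist_self, zero_add, hRdef]
      gcongr
      exact (Nat.le_ceil _).trans (by exact_mod_cast Nat.lt_two_pow_self.le)
    rw [setLAverage_eq, setLAverage_eq, div_eq_mul_inv, div_eq_mul_inv]
    calc _ ≤ (2 * CD ^ 2 * ENNReal.ofReal (R + r) * ∫⁻ w in ball x₀ R, g w ∂m) *
          (CD ^ ⌈2 * L + 1⌉₊ * (m (ball x₀ R))⁻¹) := by
          gcongr
          exact setLIntegral_potential_le hm hd hCD hg x₀ hr hR
      _ = _ := by ring
  refine le_mul_rpow_of_rpow_le hp (K := C * 2 ^ (p - 1) * 4 * CD ^ (2 + ⌈2 * L + 1⌉₊) *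
    ENNReal.ofReal (2 * L + 2)) ?_ ?_ ?_
  · simp only [ofReal_abs_sub_eq_edist]
    calc (⨍⁻ y in B, edist (f y) (⨍ z in B, f z ∂m) ∂m) ^ p
        ≤ ⨍⁻ y in B, edist (f y) (⨍ z in B, f z ∂m) ^ p ∂m :=
          laverage_rpow_le hp hB0 hBt (hf.continuous.edist continuous_const).measurable
      _ ≤ ⨍⁻ y in B, c * ((⨍⁻ z in B, F z ∂m) + F y) ∂m :=
          laverage_mono measurableSet_ball fun y hy => by rw [add_comm]; exact hpt y hy
      _ = c * (2 * ⨍⁻ z in B, F z ∂m) := by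
          rw [laverage_const_mul _ hcfin, laverage_const_add hB0 hBt, two_mul]
      _ ≤ c * (2 * (2 * CD ^ 2 * ENNReal.ofReal (R + r) *
          (CD ^ ⌈2 * L + 1⌉₊ * ⨍⁻ w in ball x₀ R, g w ∂m))) := by gcongr
      _ = C * 2 ^ (p - 1) * 4 * CD ^ (2 + ⌈2 * L + 1⌉₊) * ENNReal.ofReal (2 * L + 2) *
          ENNReal.ofReal r ^ p * ⨍⁻ w in ball x₀ R, g w ∂m := by
          have e1 : ENNReal.ofReal (R + r) = ENNReal.ofReal (2 * L + 2) * ENNReal.ofReal r := by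
            rw [← ENNReal.ofReal_mul (by linarith), hRdef]
            congr 1
            ring
          have e2 : ENNReal.ofReal r ^ p = ENNReal.ofReal r ^ (p - 1) * ENNReal.ofReal r := by
            conv_lhs => rw [show p = (p - 1) + 1 by ring]
            rw [ENNReal.rpow_add_of_nonneg _ _ (by linarith) (by norm_num), ENNReal.rpow_one]
          have e3 : c = C * (2 ^ (p - 1) * ENNReal.ofReal r ^ (p - 1)) := by
            rw [← ENNReal.mul_rpow_of_nonneg _ _ (by linarith : 0 ≤ p - 1)]
          rw [e1, e2, e3]
          ring
  · rw [ENNReal.coe_add]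
    refine le_add_left (le_of_eq ?_)
    push_cast
    rw [ENNReal.coe_rpow_of_nonneg _ (by linarith)]
    rfl
  · rw [ENNReal.coe_add]
    exact le_add_right (by simp)

end PointwiseToPoincare

/-! ### The chain distance and almost minimizing chains -/

section ChainDist

variable {X : Type u} [MetricSpace X] {δ : ℝ} {x y z : X}

/-- The infimum of the lengths of the `δ`-chains from `x` to `y`. -/
noncomputable def chainDist (δ : ℝ) (x y : X) : ℝ≥0∞ :=
  ⨅ (N : ℕ) (q : ℕ → X) (_ : IsEpsChain δ N q ∧ q 0 = x ∧ q N = y),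
    ∑ i ∈ Finset.range N, edist (q i) (q (i + 1))

theorem chainDist_le_sum {N : ℕ} {q : ℕ → X} (hq : IsEpsChain δ N q) :
    chainDist δ (q 0) (q N) ≤ ∑ i ∈ Finset.range N, edist (q i) (q (i + 1)) :=
  iInf_le_of_le N (iInf₂_le_of_le q ⟨hq, rfl, rfl⟩ le_rfl)

theorem exists_chain_of_chainDist_lt {c : ℝ≥0∞} (h : chainDist δ x y < c) :
    ∃ (N : ℕ) (q : ℕ → X), IsEpsChain δ N q ∧ q 0 = x ∧ q N = y ∧
      ∑ i ∈ Finset.range N, edist (q i) (q (i + 1)) < c := by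
  simp only [chainDist, iInf_lt_iff] at h
  obtain ⟨N, q, ⟨h1, h2, h3⟩, h4⟩ := h
  exact ⟨N, q, h1, h2, h3, h4⟩

theorem chainDist_self (δ : ℝ) (x : X) : chainDist δ x x = 0 := by
  have h := chainDist_le_sum (δ := δ) (N := 0) (q := fun _ => x) (fun i hi => by omega)
  simpa using h

theorem chainDist_le_edist (h : dist x y ≤ δ) : chainDist δ x y ≤ edist x y := by
  have h := chainDist_le_sum (δ := δ) (N := 1) (q := fun i => if i = 0 then x else y)
    (fun i hi => by
      obtain rfl : i = 0 := by omega
      simpa using h)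
  simpa using h

theorem chainDist_triangle (δ : ℝ) (x y z : X) :
    chainDist δ x z ≤ chainDist δ x y + chainDist δ y z := by
  refine ENNReal.le_of_forall_pos_le_add fun η hη hfin => ?_
  have hη2 : (0 : ℝ≥0∞) < η / 2 := by simpa using hη.ne'
  obtain ⟨N, q, hq, hq0, hqN, hs⟩ := exists_chain_of_chainDist_lt
    (ENNReal.lt_add_right (ENNReal.add_lt_top.1 hfin).1.ne hη2.ne')
  obtain ⟨N', q', hq', hq0', hqN', hs'⟩ := exists_chain_of_chainDist_lt
    (ENNReal.lt_add_right (ENNReal.add_lt_top.1 hfin).2.ne hη2.ne')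
  -- Concatenation of the two chains; at index `N` both are at `y`, which makes the second formula
  -- valid from `i = 0` on.
  set Q : ℕ → X := fun i => if i ≤ N then q i else q' (i - N) with hQ
  have hQ1 : ∀ i ≤ N, Q i = q i := fun i hi => if_pos hi
  have hQ2 : ∀ i, Q (N + i) = q' i := by
    intro i
    rcases Nat.eq_zero_or_pos i with rfl | hi
    · rw [add_zero, hQ1 N le_rfl, hqN, hq0']
    · rw [hQ]
      simp only [add_tsub_cancel_left]
      rw [if_neg (by omega)]
  have hchain : IsEpsChain δ (N + N') Q := by
    intro i hi
    rcases lt_or_ge i N with h | h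
    · rw [hQ1 i h.le, hQ1 (i + 1) h]
      exact hq i h
    · obtain ⟨j, rfl⟩ := Nat.exists_eq_add_of_le h
      rw [add_assoc, hQ2, hQ2]
      exact hq' j (by omega)
  have hle := chainDist_le_sum hchain
  rw [hQ2, hqN', hQ1 0 (Nat.zero_le _), hq0, Finset.sum_range_add] at hle
  refine hle.trans ?_
  have e1 : ∑ i ∈ Finset.range N, edist (Q i) (Q (i + 1)) =
      ∑ i ∈ Finset.range N, edist (q i) (q (i + 1)) :=
    Finset.sum_congr rfl fun i hi => by
      rw [hQ1 i (Finset.mem_range.1 hi).le, hQ1 (i + 1) (Finset.mem_range.1 hi)]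
  have e2 : ∑ i ∈ Finset.range N', edist (Q (N + i)) (Q (N + i + 1)) =
      ∑ i ∈ Finset.range N', edist (q' i) (q' (i + 1)) :=
    Finset.sum_congr rfl fun i _ => by rw [add_assoc, hQ2, hQ2]
  rw [e1, e2]
  calc _ ≤ (chainDist δ x y + η / 2) + (chainDist δ y z + η / 2) := add_le_add hs.le hs'.le
    _ = chainDist δ x y + chainDist δ y z + (η / 2 + η / 2) := by ring
    _ = _ := by rw [ENNReal.add_halves]

theorem chainDist_le_sum_Ico {N a b : ℕ} {q : ℕ → X} (hq : IsEpsChain δ N q) (hab : a ≤ b)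
    (hbN : b ≤ N) : chainDist δ (q a) (q b) ≤ ∑ i ∈ Finset.Ico a b, edist (q i) (q (i + 1)) := by
  have h := chainDist_le_sum (δ := δ) (N := b - a) (q := fun i => q (a + i))
    (fun i hi => hq (a + i) (by omega))
  rw [Finset.sum_Ico_eq_sum_range]
  simpa [Nat.add_sub_cancel' hab, add_assoc] using h

/-- Almost length-minimizing chains: also all their subchains are almost minimizing. -/
theorem exists_almost_minimizing_chain (hxy : chainDist δ x y ≠ ⊤) {η : ℝ≥0∞} (hη : η ≠ 0) :
    ∃ (N : ℕ) (q : ℕ → X), IsEpsChain δ N q ∧ q 0 = x ∧ q N = y ∧ ∀ a b, a ≤ b → b ≤ N →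
      ∑ i ∈ Finset.Ico a b, edist (q i) (q (i + 1)) ≤ chainDist δ (q a) (q b) + η := by
  obtain ⟨N, q, hq, hq0, hqN, hs⟩ := exists_chain_of_chainDist_lt (ENNReal.lt_add_right hxy hη)
  refine ⟨N, q, hq, hq0, hqN, fun a b hab hbN => ?_⟩
  have hfin : ∀ s : Finset ℕ, ∑ i ∈ s, edist (q i) (q (i + 1)) ≠ ⊤ := fun s =>
    ENNReal.sum_ne_top.2 fun i _ => edist_ne_top _ _
  have hsplit : ∑ i ∈ Finset.range N, edist (q i) (q (i + 1)) =
      (∑ i ∈ Finset.Ico 0 a, edist (q i) (q (i + 1)) +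
        ∑ i ∈ Finset.Ico b N, edist (q i) (q (i + 1))) +
        ∑ i ∈ Finset.Ico a b, edist (q i) (q (i + 1)) := by
    rw [Finset.range_eq_Ico, ← Finset.sum_Ico_consecutive _ (Nat.zero_le a) (hab.trans hbN),
      ← Finset.sum_Ico_consecutive _ hab hbN]
    ring
  have h1 := chainDist_le_sum_Ico hq (Nat.zero_le a) (hab.trans hbN)
  have h2 := chainDist_le_sum_Ico hq hbN le_rfl
  rw [hq0] at h1
  rw [hqN] at h2
  rw [hsplit] at hs
  have h3 : chainDist δ x y ≤ chainDist δ x (q a) + (chainDist δ (q a) (q b) +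
      chainDist δ (q b) y) :=
    (chainDist_triangle δ x (q a) y).trans (by gcongr; exact chainDist_triangle δ _ _ _)
  -- The two outer pieces appear on both sides and are finite, so they cancel and leave the excess
  -- `η` on the subchain.
  have h4 : (∑ i ∈ Finset.Ico 0 a, edist (q i) (q (i + 1)) +
        ∑ i ∈ Finset.Ico b N, edist (q i) (q (i + 1))) +
        ∑ i ∈ Finset.Ico a b, edist (q i) (q (i + 1)) ≤
      (∑ i ∈ Finset.Ico 0 a, edist (q i) (q (i + 1)) +
        ∑ i ∈ Finset.Ico b N, edist (q i) (q (i + 1))) + (chainDist δ (q a) (q b) + η) := by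
    refine hs.le.trans ?_
    calc chainDist δ x y + η ≤ (∑ i ∈ Finset.Ico 0 a, edist (q i) (q (i + 1)) +
          (chainDist δ (q a) (q b) + ∑ i ∈ Finset.Ico b N, edist (q i) (q (i + 1)))) + η := by
          gcongr
          exact h3.trans (by gcongr)
      _ = _ := by ring
  exact (ENNReal.add_le_add_iff_left (ENNReal.add_ne_top.2 ⟨hfin _, hfin _⟩)).1 h4

end ChainDist

/-! ### The Poincaré inequality makes the space chain-quasiconvex -/

section Quasiconvexity

variable {X : Type u} [MetricSpace X] [MeasurableSpace X] [BorelSpace X] {m : Measure X}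
  {CD C : ℝ≥0} {p Λ : ℝ}

theorem edist_average_le_of_subset (hm : IsMetricMeasureSpace m) (hd : IsDoubling m CD)
    {f : X → ℝ} {L : ℝ≥0} (hf : LipschitzWith L f) {x y : X} {r s : ℝ} (hs : 0 < s)
    (hsub : ball y s ⊆ ball x r) {K : ℝ≥0} (hK : K ≠ 0)
    (hKm : m (ball x r) ≤ K * m (ball y s)) (c : ℝ) :
    edist (⨍ z in ball y s, f z ∂m) c ≤ K * ⨍⁻ z in ball x r, edist (f z) c ∂m :=
  (edist_average_le (hd.measure_ball_pos hm y hs).ne' (hm.measure_ball_lt_top y s).ne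
    (hm.integrableOn_ball hf y s) c).trans (laverage_le_of_subset hsub hK hKm _)

theorem LipPoincare.edist_average_le (hP : LipPoincare m p C Λ) (hm : IsMetricMeasureSpace m)
    (hd : IsDoubling m CD) {f : X → ℝ} {L : ℝ≥0} (hf : LipschitzWith L f) {x y : X} {r s : ℝ}
    (hr : 0 < r) (hs : 0 < s) (hsub : ball y s ⊆ ball x r) {K : ℝ≥0} (hK : K ≠ 0)
    (hKm : m (ball x r) ≤ K * m (ball y s)) :
    edist (⨍ z in ball y s, f z ∂m) (⨍ z in ball x r, f z ∂m) ≤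
      K * (C * ENNReal.ofReal r * (⨍⁻ z in ball x (Λ * r), lip f z ^ p ∂m) ^ (1 / p)) := by
  refine (edist_average_le_of_subset hm hd hf hs hsub hK hKm _).trans ?_
  have h := hP f ⟨L, hf⟩ x r hr
  simp only [ofReal_abs_sub_eq_edist] at h
  gcongr

theorem laverage_rpow_rpow_le_one (hp : 1 ≤ p) {g : X → ℝ≥0∞} (hg : ∀ z, g z ≤ 1) (x : X)
    (r : ℝ) : (⨍⁻ z in ball x r, g z ^ p ∂m) ^ (1 / p) ≤ 1 := by
  refine ENNReal.rpow_le_one ?_ (by positivity)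
  refine (laverage_mono measurableSet_ball (ψ := fun _ => 1) fun z _ =>
    ENNReal.rpow_le_one (hg z) (by linarith)).trans ?_
  rw [setLAverage_eq, setLIntegral_const, one_mul]
  exact ENNReal.div_self_le_one

/-- Telescoping over the balls of radius `r / 2 ^ n`; as `lip f ≤ 1`, the successive differences of
averages decay geometrically. -/
theorem LipPoincare.edist_average_self_le (hP : LipPoincare m p C Λ) (hm : IsMetricMeasureSpace m)
    (hd : IsDoubling m CD) (hCD : 1 ≤ CD) (hp : 1 ≤ p) {f : X → ℝ} {L : ℝ≥0}
    (hf : LipschitzWith L f) (hlip : ∀ z, lip f z ≤ 1) (x : X) {r : ℝ} (hr : 0 < r) :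
    edist (⨍ z in ball x r, f z ∂m) (f x) ≤ 2 * (CD * C * ENNReal.ofReal r) := by
  have htend : Tendsto (fun n : ℕ => ⨍ z in ball x (r / 2 ^ n), f z ∂m) atTop (𝓝 (f x)) := by
    refine (isLebesguePoint_of_lipschitzWith hm hd hf x).2.comp ?_
    refine tendsto_nhdsWithin_iff.2 ⟨?_, Eventually.of_forall fun n => by
      simp only [Set.mem_Ioi]; positivity⟩
    exact tendsto_const_nhds.div_atTop (tendsto_pow_atTop_atTop_of_one_lt one_lt_two)
  have h := edist_le_of_edist_le_geometric_two_of_tendsto₀ (CD * C * ENNReal.ofReal r)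
    (f := fun n : ℕ => ⨍ z in ball x (r / 2 ^ n), f z ∂m) (fun n => ?_) htend
  · simpa using h
  · have hn : 0 < r / 2 ^ n := by positivity
    have hn' : 0 < r / 2 ^ (n + 1) := by positivity
    have he : r / 2 ^ n = 2 * (r / 2 ^ (n + 1)) := by rw [pow_succ]; field_simp
    rw [edist_comm]
    refine (hP.edist_average_le hm hd hf hn hn' (ball_subset_ball (by rw [he]; linarith))
      (K := CD) (by positivity) (by rw [he]; exact hd _ _ hn')).trans ?_
    have hone := laverage_rpow_rpow_le_one (m := m) hp hlip x (Λ * (r / 2 ^ n))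
    calc _ ≤ (CD : ℝ≥0∞) * (C * ENNReal.ofReal (r / 2 ^ n) * 1) := by gcongr
      _ = _ := by
        rw [ENNReal.ofReal_div_of_pos (by positivity), ENNReal.ofReal_pow (by norm_num),
          ENNReal.ofReal_ofNat]
        simp only [div_eq_mul_inv]
        ring

/-- The a priori Lipschitz constant `L` disappears from the bound. This is what makes the chain
distance bound independent of `δ`. -/
theorem LipPoincare.edist_le_of_lip_le_one (hP : LipPoincare m p C Λ)
    (hm : IsMetricMeasureSpace m) (hd : IsDoubling m CD) (hCD : 1 ≤ CD) (hp : 1 ≤ p)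
    {f : X → ℝ} {L : ℝ≥0} (hf : LipschitzWith L f) (hlip : ∀ z, lip f z ≤ 1) (x y : X) :
    edist (f x) (f y) ≤ 8 * CD ^ 2 * C * edist x y := by
  rcases eq_or_ne x y with rfl | hxy
  · simp
  have hr : 0 < dist x y := dist_pos.2 hxy
  set r := dist x y with hrdef
  have hCD' : (1 : ℝ≥0∞) ≤ CD := by exact_mod_cast hCD
  have h1 := hP.edist_average_self_le hm hd hCD hp hf hlip x hr
  have h2 := hP.edist_average_self_le hm hd hCD hp hf hlip y (r := 2 * r) (by positivity)
  have h3 : edist (⨍ z in ball x r, f z ∂m) (⨍ z in ball y (2 * r), f z ∂m) ≤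
      CD ^ 2 * (C * ENNReal.ofReal (2 * r)) := by
    refine (hP.edist_average_le hm hd hf (by positivity) hr
      (ball_subset_ball' (by rw [← hrdef]; linarith)) (K := CD ^ 2) (by positivity) ?_).trans ?_
    · rw [ENNReal.coe_pow]
      exact hd.measure_ball_le hr 2 (by rw [dist_comm, ← hrdef]; linarith)
    · rw [ENNReal.coe_pow]
      refine mul_le_mul_right ?_ _
      exact mul_le_of_le_one_right' (laverage_rpow_rpow_le_one hp hlip _ _)
  have he : ENNReal.ofReal (2 * r) = 2 * ENNReal.ofReal r := by
    rw [ENNReal.ofReal_mul (by norm_num), ENNReal.ofReal_ofNat]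
  rw [he] at h2 h3
  rw [edist_dist x y, ← hrdef]
  calc edist (f x) (f y) ≤ edist (f x) (⨍ z in ball x r, f z ∂m) +
        edist (⨍ z in ball x r, f z ∂m) (⨍ z in ball y (2 * r), f z ∂m) +
        edist (⨍ z in ball y (2 * r), f z ∂m) (f y) := edist_triangle4 _ _ _ _
    _ ≤ 2 * (CD * C * ENNReal.ofReal r) + CD ^ 2 * (C * (2 * ENNReal.ofReal r)) +
        2 * (CD * C * (2 * ENNReal.ofReal r)) := by
        rw [edist_comm (f x)]
        gcongr
    _ = 6 * (CD * 1) * C * ENNReal.ofReal r + 2 * CD ^ 2 * C * ENNReal.ofReal r := by ring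
    _ ≤ 6 * (CD * CD) * C * ENNReal.ofReal r + 2 * CD ^ 2 * C * ENNReal.ofReal r := by gcongr
    _ = _ := by ring

theorem LipPoincare.chainDist_le (hP : LipPoincare m p C Λ) (hm : IsMetricMeasureSpace m)
    (hd : IsDoubling m CD) (hCD : 1 ≤ CD) (hp : 1 ≤ p) {δ : ℝ} (hδ : 0 < δ)
    (x y : X) : chainDist δ x y ≤ 8 * CD ^ 2 * C * edist x y := by
  -- Capping at `M` makes the chain distance finite and globally Lipschitz, with a constant
  -- depending on `δ` that plays no role later. The extra `1` excludes that the cap is attained at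
  -- `y`.
  set M : ℝ≥0∞ := 8 * CD ^ 2 * C * edist x y + 1 with hM
  have hMtop : M ≠ ⊤ := by
    have := edist_ne_top x y
    finiteness
  have hmin : ∀ z, min (chainDist δ x z) M ≠ ⊤ := fun z =>
    ((min_le_right _ _).trans_lt hMtop.lt_top).ne
  set f : X → ℝ := fun z => (min (chainDist δ x z) M).toReal
  have hloc : ∀ z w, dist z w ≤ δ → f z ≤ f w + dist z w := by
    intro z w hzw
    rw [← ENNReal.toReal_ofReal (dist_nonneg (x := z) (y := w)), ← edist_dist,
      ← ENNReal.toReal_add (hmin w) (edist_ne_top z w)]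
    refine ENNReal.toReal_mono (ENNReal.add_ne_top.2 ⟨hmin w, edist_ne_top z w⟩) ?_
    rw [min_add]
    refine le_min ((min_le_left _ _).trans ?_) ((min_le_right _ _).trans le_self_add)
    rw [edist_comm]
    exact (chainDist_triangle δ x w z).trans
      (by gcongr; exact chainDist_le_edist (by rwa [dist_comm]))
  have hloc' : ∀ z w, dist z w ≤ δ → dist (f z) (f w) ≤ dist z w := by
    intro z w hzw
    rw [Real.dist_eq, abs_sub_le_iff]
    have h1 := hloc z w hzw
    have h2 := hloc w z (by rwa [dist_comm])
    rw [dist_comm w z] at h2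
    constructor <;> linarith
  have hbd : ∀ z, 0 ≤ f z ∧ f z ≤ M.toReal := fun z =>
    ⟨ENNReal.toReal_nonneg, ENNReal.toReal_mono hMtop (min_le_right _ _)⟩
  have hLip : LipschitzWith (1 + (M.toReal / δ).toNNReal) f := by
    refine LipschitzWith.of_dist_le_mul fun z w => ?_
    rw [NNReal.coe_add, NNReal.coe_one, Real.coe_toNNReal _ (by positivity)]
    rcases le_or_gt (dist z w) δ with h | h
    · refine (hloc' z w h).trans ?_
      have : 0 ≤ M.toReal / δ * dist z w := by positivity
      linarith
    · have h1 : dist (f z) (f w) ≤ M.toReal := by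
        rw [Real.dist_eq, abs_sub_le_iff]
        constructor <;> linarith [hbd z, hbd w]
      have h2 : M.toReal ≤ M.toReal / δ * dist z w := by
        rw [div_mul_eq_mul_div, le_div_iff₀ hδ]
        gcongr
      linarith [dist_nonneg (x := z) (y := w)]
  have hlip1 : ∀ z, lip f z ≤ 1 := fun z => (lip_le_slope f hδ z).trans <| slope_le fun w hw => by
    rw [one_mul, edist_dist, edist_dist]
    exact ENNReal.ofReal_le_ofReal (hloc' w z hw.le)
  have h := hP.edist_le_of_lip_le_one hm hd hCD hp hLip hlip1 x y
  have hx : f x = 0 := by simp [f, chainDist_self]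
  rw [hx, edist_comm, edist_dist, Real.dist_eq, sub_zero, abs_of_nonneg (hbd y).1,
    ENNReal.ofReal_toReal (hmin y)] at h
  rcases min_le_iff.1 h with h | h
  · exact h
  · exact absurd h (not_le.2 (ENNReal.lt_add_right (by
      have := edist_ne_top x y
      finiteness) one_ne_zero))

/-- A chain with steps of half the width cannot jump over an annulus. This guarantees that annuli
around a pole carry mass. -/
theorem exists_dist_mem_Ioo_of_chainDist_ne_top (h : ∀ δ > 0, ∀ x y : X, chainDist δ x y ≠ ⊤)
    {x y : X} {a b : ℝ} (ha : 0 ≤ a) (hab : a < b) (hb : b ≤ dist x y) :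
    ∃ z, a < dist x z ∧ dist x z < b := by
  obtain ⟨N, q, hq, hq0, hqN, _⟩ := exists_chain_of_chainDist_lt
    (h ((b - a) / 2) (by linarith) x y).lt_top
  have hex : ∃ i, i ≤ N ∧ a < dist x (q i) := ⟨N, le_rfl, by rw [hqN]; linarith⟩
  classical
  have hspec := Nat.find_spec hex
  have hmin := fun i (hi : i < Nat.find hex) => Nat.find_min hex hi
  set i := Nat.find hex
  refine ⟨q i, hspec.2, ?_⟩
  have hi0 : i ≠ 0 := by
    intro h0
    rw [h0, hq0, dist_self] at hspec
    linarith [hspec.2]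
  obtain ⟨j, hj⟩ := Nat.exists_eq_succ_of_ne_zero hi0
  have h1 := hmin j (by omega)
  have h2 : dist x (q j) ≤ a := by
    by_contra hcon
    exact h1 ⟨by omega, not_le.1 hcon⟩
  have h3 := hq j (by omega)
  have h4 := dist_triangle x (q j) (q (j + 1))
  rw [hj]
  change dist x (q (j + 1)) < b
  linarith

end Quasiconvexity

/-! ### Telescoping and bounded overlap along chains -/

section ChainEstimate

variable {X : Type u} [MetricSpace X] [MeasurableSpace X] [BorelSpace X] {m : Measure X}
  {CD C : ℝ≥0} {p Λ : ℝ}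

theorem average_eq_of_eqOn_ball (hm : IsMetricMeasureSpace m) (hd : IsDoubling m CD)
    {f : X → ℝ} {L : ℝ≥0} (hf : LipschitzWith L f) {x : X} {r c : ℝ} (hr : 0 < r)
    (h : ∀ z ∈ ball x r, f z = c) : ⨍ z in ball x r, f z ∂m = c := by
  rw [← edist_eq_zero, ← nonpos_iff_eq_zero]
  refine (edist_average_le (hd.measure_ball_pos hm x hr).ne' (hm.measure_ball_lt_top x r).ne
    (hm.integrableOn_ball hf x r) c).trans ?_
  refine (laverage_mono measurableSet_ball (ψ := fun _ => 0) fun z hz => ?_).trans ?_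
  · rw [h z hz, edist_self]
  · simp

/-- Comparison of the averages over two balls whose radii are small multiples of a
`1`-Lipschitz radius function. -/
theorem LipPoincare.edist_average_le_of_dist_le (hP : LipPoincare m p C Λ)
    (hm : IsMetricMeasureSpace m) (hd : IsDoubling m CD) (hCD : 1 ≤ CD) (hΛ : 1 ≤ Λ)
    {f : X → ℝ} {L : ℝ≥0} (hf : LipschitzWith L f) {R : X → ℝ} (hR : ∀ z, 0 < R z)
    (hRL : ∀ z w, R z ≤ R w + dist z w) {z w : X} (hzw : dist z w ≤ 2 * (R z / (40 * Λ))) :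
    edist (⨍ v in ball z (R z / (40 * Λ)), f v ∂m) (⨍ v in ball w (R w / (40 * Λ)), f v ∂m) ≤
      8 * CD ^ 4 * C * ENNReal.ofReal (R z / (40 * Λ)) *
        (⨍⁻ v in ball z (R z / 10), lip f v ^ p ∂m) ^ (1 / p) := by
  have hΛ0 : 0 < 40 * Λ := by positivity
  set r := R z / (40 * Λ) with hr
  set s := R w / (40 * Λ) with hs
  have hr0 : 0 < r := div_pos (hR z) hΛ0
  have hs0 : 0 < s := div_pos (hR w) hΛ0
  have hRz : R z = 40 * Λ * r := by rw [hr]; field_simp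
  have hRw : R w = 40 * Λ * s := by rw [hs]; field_simp
  have h1 := hRL z w
  have h2 := hRL w z
  rw [dist_comm w z] at h2
  have h3 : 2 * r ≤ 2 * Λ * r := by nlinarith
  have h4 : s ≤ 2 * r := by
    have : 40 * Λ * s ≤ 40 * Λ * (2 * r) := by linarith
    exact le_of_mul_le_mul_left this hΛ0
  have h5 : r ≤ 2 * s := by
    have : 40 * Λ * r ≤ 40 * Λ * (2 * s) := by linarith
    exact le_of_mul_le_mul_left this hΛ0
  have hCD' : (1 : ℝ≥0∞) ≤ CD := by exact_mod_cast hCD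
  have e1 := hP.edist_average_le hm hd hf (x := z) (y := z) (r := 4 * r) (s := r) (by positivity)
    hr0 (ball_subset_ball (by linarith)) (K := CD ^ 4) (by positivity) (by
      rw [ENNReal.coe_pow]
      exact hd.measure_ball_le hr0 4 (by rw [dist_self]; linarith))
  have e2 := hP.edist_average_le hm hd hf (x := z) (y := w) (r := 4 * r) (s := s) (by positivity)
    hs0 (ball_subset_ball' (by rw [dist_comm]; linarith)) (K := CD ^ 4) (by positivity) (by
      rw [ENNReal.coe_pow]
      exact hd.measure_ball_le hs0 4 (by linarith))
  -- The factor `40 * Λ` is chosen for this: the enlarged ball in the Poincaré inequality is still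
  -- small compared with `R z`.
  have hball : Λ * (4 * r) = R z / 10 := by rw [hRz]; ring
  rw [hball, ENNReal.coe_pow, ENNReal.ofReal_mul (by norm_num), ENNReal.ofReal_ofNat] at e1 e2
  rw [edist_comm (⨍ v in ball w s, f v ∂m)] at e2
  refine (edist_triangle _ _ _).trans ((add_le_add e1 e2).trans (le_of_eq ?_))
  ring

/-- Allows the average at a stopping vertex to be replaced by averages at the vertices passed before
the next one, so that the sum runs over all chain steps. -/
theorem laverage_rpow_le_laverage_rpow (hd : IsDoubling m CD) (hCD : 1 ≤ CD)
    (hp : 1 ≤ p) {R : X → ℝ} (hR : ∀ z, 0 < R z) (hRL : ∀ z w, R z ≤ R w + dist z w) {z w : X}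
    (hzw : dist z w ≤ R z / 40) (φ : X → ℝ≥0∞) :
    (⨍⁻ v in ball z (R z / 10), φ v ∂m) ^ (1 / p) ≤
      CD ^ 2 * (⨍⁻ v in ball w (R w / 4), φ v ∂m) ^ (1 / p) := by
  have h1 := hRL z w
  have h2 := hRL w z
  rw [dist_comm w z] at h2
  have hz := hR z
  have h := laverage_le_of_subset (m := m) (s := ball z (R z / 10)) (t := ball w (R w / 4))
    (ball_subset_ball' (by linarith)) (K := CD ^ 2) (by positivity) (by
      rw [ENNReal.coe_pow]
      exact hd.measure_ball_le (by positivity) 2 (by rw [dist_comm]; linarith)) φ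
  have hp0 : 0 < p := by linarith
  calc _ ≤ (((CD ^ 2 : ℝ≥0) : ℝ≥0∞) * ⨍⁻ v in ball w (R w / 4), φ v ∂m) ^ (1 / p) := by gcongr
    _ = ((CD ^ 2 : ℝ≥0) : ℝ≥0∞) ^ (1 / p) * (⨍⁻ v in ball w (R w / 4), φ v ∂m) ^ (1 / p) :=
        ENNReal.mul_rpow_of_nonneg _ _ (by positivity)
    _ ≤ _ := by
        gcongr
        rw [← ENNReal.coe_pow]
        calc ((CD ^ 2 : ℝ≥0) : ℝ≥0∞) ^ (1 / p) ≤ ((CD ^ 2 : ℝ≥0) : ℝ≥0∞) ^ (1 : ℝ) := by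
              refine ENNReal.rpow_le_rpow_of_exponent_le ?_ ?_
              · exact_mod_cast one_le_pow₀ hCD
              · rw [div_le_one hp0]; exact hp
          _ = _ := ENNReal.rpow_one _

/-- Telescoping along a fine chain. -/
theorem LipPoincare.edist_average_le_sum (hP : LipPoincare m p C Λ)
    (hm : IsMetricMeasureSpace m) (hd : IsDoubling m CD) (hCD : 1 ≤ CD) (hp : 1 ≤ p)
    (hΛ : 1 ≤ Λ) {f : X → ℝ} {L : ℝ≥0} (hf : LipschitzWith L f) {R : X → ℝ} (hR : ∀ z, 0 < R z)
    (hRL : ∀ z w, R z ≤ R w + dist z w) {δ : ℝ} (hδ : ∀ z, δ ≤ R z / (40 * Λ)) {N : ℕ} {q : ℕ → X}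
    (hq : IsEpsChain δ N q) {c : ℝ}
    (hend : ∀ z, dist z (q N) < R z / (40 * Λ) → ⨍ v in ball z (R z / (40 * Λ)), f v ∂m = c)
    (n : ℕ) : ∀ a, a + n = N →
    edist (⨍ v in ball (q a) (R (q a) / (40 * Λ)), f v ∂m) c ≤
      8 * CD ^ 6 * C * ∑ i ∈ Finset.Ico a N, edist (q i) (q (i + 1)) *
        (⨍⁻ v in ball (q i) (R (q i) / 4), lip f v ^ p ∂m) ^ (1 / p) := by
  induction n using Nat.strong_induction_on with
  | _ n ih =>
  intro a han
  have hΛ0 : 0 < 40 * Λ := by positivity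
  -- The next stopping vertex is the first to leave the small ball about `q a`. The chain up to it
  -- is at least as long as that radius, and as steps are at most `δ` it overshoots by at most a
  -- factor two.
  by_cases hex : ∃ b, a < b ∧ b ≤ N ∧ R (q a) / (40 * Λ) ≤ dist (q a) (q b)
  · classical
    have hspec := Nat.find_spec hex
    have hmin := fun i (hi : i < Nat.find hex) => Nat.find_min hex hi
    set b := Nat.find hex
    have hlt : ∀ i ∈ Finset.Ico a b, dist (q a) (q i) < R (q a) / (40 * Λ) := by
      intro i hi
      rw [Finset.mem_Ico] at hi
      rcases hi.1.eq_or_lt with rfl | hai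
      · rw [dist_self]; exact div_pos (hR _) hΛ0
      · by_contra hcon
        exact hmin i hi.2 ⟨hai, by omega, not_lt.1 hcon⟩
    have hle : dist (q a) (q b) ≤ 2 * (R (q a) / (40 * Λ)) := by
      obtain ⟨j, hj⟩ := Nat.exists_eq_succ_of_ne_zero (show b ≠ 0 by omega)
      have h1 := (hlt j (Finset.mem_Ico.2 (by omega))).le
      have h2 := (hq j (by omega)).trans (hδ (q a))
      rw [hj]
      exact (dist_triangle _ (q j) _).trans (by rw [two_mul]; exact add_le_add h1 h2)
    have h1 := hP.edist_average_le_of_dist_le hm hd hCD hΛ hf hR hRL hle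
    have h2 := ih (N - b) (by omega) b (by omega)
    rw [← Finset.sum_Ico_consecutive _ hspec.1.le hspec.2.1, mul_add]
    refine (edist_triangle _ _ _).trans (add_le_add (h1.trans ?_) h2)
    have h3 : ENNReal.ofReal (R (q a) / (40 * Λ)) ≤
        ∑ i ∈ Finset.Ico a b, edist (q i) (q (i + 1)) := by
      refine le_trans ?_ (edist_le_Ico_sum_edist q hspec.1.le)
      rw [edist_dist]
      exact ENNReal.ofReal_le_ofReal hspec.2.2
    calc _ ≤ 8 * CD ^ 4 * C * (∑ i ∈ Finset.Ico a b, edist (q i) (q (i + 1))) *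
          (⨍⁻ v in ball (q a) (R (q a) / 10), lip f v ^ p ∂m) ^ (1 / p) := by gcongr
      _ = 8 * CD ^ 4 * C * ∑ i ∈ Finset.Ico a b, edist (q i) (q (i + 1)) *
          (⨍⁻ v in ball (q a) (R (q a) / 10), lip f v ^ p ∂m) ^ (1 / p) := by
          rw [mul_assoc, Finset.sum_mul]
      _ ≤ 8 * CD ^ 4 * C * ∑ i ∈ Finset.Ico a b, edist (q i) (q (i + 1)) *
          (CD ^ 2 * (⨍⁻ v in ball (q i) (R (q i) / 4), lip f v ^ p ∂m) ^ (1 / p)) := by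
          gcongr with i hi
          refine laverage_rpow_le_laverage_rpow hd hCD hp hR hRL ((hlt i hi).le.trans ?_) _
          exact div_le_div_of_nonneg_left (hR _).le (by norm_num) (by linarith)
      _ = _ := by
          rw [Finset.mul_sum, Finset.mul_sum]
          exact Finset.sum_congr rfl fun i _ => by ring
  -- No later vertex leaves the small ball, so the endpoint of the chain lies in it and `hend` gives
  -- the average.
  · push Not at hex
    rcases Nat.eq_zero_or_pos n with rfl | hn
    · rw [hend (q a) (by
        rw [← han, add_zero, dist_self]; exact div_pos (hR _) hΛ0), edist_self]
      exact bot_le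
    · rw [hend (q a) (hex N (by omega) le_rfl), edist_self]
      exact bot_le

/-- Bounded overlap along an almost minimizing chain. -/
theorem sum_indicator_ball_le (hd : IsDoubling m CD) (hCD : 1 ≤ CD)
    {R : X → ℝ} (hR : ∀ z, 0 < R z) (hRL : ∀ z w, R z ≤ R w + dist z w) {δ : ℝ} {C₀ η : ℝ≥0∞}
    (hC₀ : ∀ z w : X, chainDist δ z w ≤ C₀ * edist z w) {N : ℕ} {q : ℕ → X}
    (hq : IsEpsChain δ N q)
    (hqmin : ∀ a b, a ≤ b → b ≤ N →
      ∑ i ∈ Finset.Ico a b, edist (q i) (q (i + 1)) ≤ chainDist δ (q a) (q b) + η)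
    (z : X) (hδ : δ ≤ R z / 3) (hη : η ≤ ENNReal.ofReal (R z)) :
    ∑ i ∈ Finset.range N, edist (q i) (q (i + 1)) *
      ((m (ball (q i) (R (q i) / 4)))⁻¹ * (ball (q i) (R (q i) / 4)).indicator 1 z) ≤
      CD ^ 3 * (C₀ + 1) * (ENNReal.ofReal (R z) / m (ball z (R z))) := by
  classical
  set S := (Finset.range N).filter fun i => z ∈ ball (q i) (R (q i) / 4) with hS
  have hsum : ∑ i ∈ Finset.range N, edist (q i) (q (i + 1)) *
      ((m (ball (q i) (R (q i) / 4)))⁻¹ * (ball (q i) (R (q i) / 4)).indicator 1 z) =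
      ∑ i ∈ S, edist (q i) (q (i + 1)) * (m (ball (q i) (R (q i) / 4)))⁻¹ := by
    rw [hS, Finset.sum_filter]
    refine Finset.sum_congr rfl fun i _ => ?_
    by_cases hi : z ∈ ball (q i) (R (q i) / 4)
    · rw [if_pos hi, Set.indicator_of_mem hi]; simp
    · rw [if_neg hi, Set.indicator_of_notMem hi]; simp
  rw [hsum]
  have hfacts : ∀ i ∈ S, i < N ∧ dist z (q i) < R z / 3 ∧ dist z (q i) < R (q i) / 4 ∧
      R z ≤ 5 / 4 * R (q i) := by
    intro i hi
    obtain ⟨h1, h2⟩ := Finset.mem_filter.1 hi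
    rw [mem_ball] at h2
    have h3 := hRL z (q i)
    have h4 := hRL (q i) z
    rw [dist_comm (q i) z] at h4
    refine ⟨Finset.mem_range.1 h1, ?_, h2, ?_⟩ <;> linarith
  rcases S.eq_empty_or_nonempty with hemp | hne
  · rw [hemp, Finset.sum_empty]; exact bot_le
  -- The first and last vertices whose ball contains `z` are within `R z / 3` of `z`; one more step
  -- of length at most `R z / 3` leaves the ends of this stretch at most `R z` apart.
  -- Near-minimality bounds its whole length, including vertices whose ball misses `z`.
  have hlen : ∑ i ∈ S, edist (q i) (q (i + 1)) ≤ (C₀ + 1) * ENNReal.ofReal (R z) := by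
    set a := S.min' hne
    set b := S.max' hne
    have ha := hfacts a (S.min'_mem hne)
    have hb := hfacts b (S.max'_mem hne)
    have hab : a ≤ b := S.min'_le _ (S.max'_mem hne)
    calc ∑ i ∈ S, edist (q i) (q (i + 1)) ≤ ∑ i ∈ Finset.Ico a (b + 1), edist (q i) (q (i + 1)) := by
          refine Finset.sum_le_sum_of_subset fun i hi => Finset.mem_Ico.2
            ⟨S.min'_le i hi, Nat.lt_succ_of_le (S.le_max' i hi)⟩
      _ ≤ chainDist δ (q a) (q (b + 1)) + η := hqmin a (b + 1) (by omega) (by omega)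
      _ ≤ C₀ * edist (q a) (q (b + 1)) + ENNReal.ofReal (R z) := by
          gcongr
          exact hC₀ _ _
      _ ≤ C₀ * ENNReal.ofReal (R z) + ENNReal.ofReal (R z) := by
          gcongr
          rw [edist_dist]
          refine ENNReal.ofReal_le_ofReal ?_
          have h1 := hq b hb.1
          have h2 := dist_triangle4 (q a) z (q b) (q (b + 1))
          rw [dist_comm (q a) z] at h2
          linarith [ha.2.1, hb.2.1]
      _ = _ := by ring
  calc ∑ i ∈ S, edist (q i) (q (i + 1)) * (m (ball (q i) (R (q i) / 4)))⁻¹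
      ≤ ∑ i ∈ S, edist (q i) (q (i + 1)) * (CD ^ 3 * (m (ball z (R z)))⁻¹) := by
        gcongr with i hi
        have h := hfacts i hi
        refine inv_le_mul_inv (hd.measure_ball_le (by have := hR (q i); positivity) 3 ?_)
          (pow_ne_zero _ (by positivity)) (ENNReal.pow_ne_top ENNReal.coe_ne_top)
        linarith [h.2.2.1, h.2.2.2, hR (q i)]
    _ = (∑ i ∈ S, edist (q i) (q (i + 1))) * (CD ^ 3 * (m (ball z (R z)))⁻¹) := by
        rw [Finset.sum_mul]
    _ ≤ ((C₀ + 1) * ENNReal.ofReal (R z)) * (CD ^ 3 * (m (ball z (R z)))⁻¹) := by gcongr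
    _ = _ := by rw [div_eq_mul_inv]; ring

end ChainEstimate

/-! ### The estimate for Lipschitz functions constant near the poles -/

section LocallyConstant

variable {X : Type u} [MetricSpace X] [MeasurableSpace X] [BorelSpace X] {m : Measure X}
  {CD C : ℝ≥0} {p Λ : ℝ}

/-- Hölder's inequality for the weights `w`; below they are the step lengths, whose sum is
controlled by `edist x y`. -/
theorem sum_mul_rpow_le {ι : Type*} (s : Finset ι) (hp : 1 ≤ p) (w h : ι → ℝ≥0∞) :
    (∑ i ∈ s, w i * h i ^ (1 / p)) ^ p ≤ (∑ i ∈ s, w i) ^ (p - 1) * ∑ i ∈ s, w i * h i := by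
  have hp0 : 0 < p := by linarith
  have h1 := ENNReal.rpow_le_rpow
    (ENNReal.inner_le_weight_mul_Lp_of_nonneg s hp w fun i => h i ^ (1 / p)) hp0.le
  rw [ENNReal.mul_rpow_of_nonneg _ _ hp0.le, ← ENNReal.rpow_mul, ← ENNReal.rpow_mul,
    inv_mul_cancel₀ hp0.ne', ENNReal.rpow_one, sub_mul, one_mul, inv_mul_cancel₀ hp0.ne'] at h1
  refine h1.trans (le_of_eq ?_)
  congr 1
  refine Finset.sum_congr rfl fun i _ => ?_
  rw [← ENNReal.rpow_mul, one_div_mul_cancel hp0.ne', ENNReal.rpow_one]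

/-- The overlap bound produces a kernel centred at `z`; it is compared with the summand of the Riesz
density at the nearer pole. -/
theorem ofReal_min_dist_div_le (hd : IsDoubling m CD) (hCD : 1 ≤ CD) {L : ℝ} {x y z : X}
    (hx : z ≠ x) (hy : z ≠ y) (h : z ∈ ball x (L * dist x y) ∪ ball y (L * dist x y)) :
    ENNReal.ofReal (min (dist x z) (dist y z)) / m (ball z (min (dist x z) (dist y z))) ≤
      CD * riesz m L x y z := by
  rw [riesz_eq hx hy h, mul_add]
  have hk : ∀ w : X, ENNReal.ofReal (dist w z) / m (ball z (dist w z)) ≤ CD * kernel m w z := by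
    intro w
    refine le_trans (le_of_eq ?_) (kernel_swap_le hd hCD z w)
    rw [kernel, edist_dist, dist_comm]
  rcases min_choice (dist x z) (dist y z) with h | h <;> rw [h]
  · exact (hk x).trans le_self_add
  · exact (hk y).trans le_add_self

/-- In the constant, `8 * CD ^ 6 * C` comes from telescoping. The power `p` of `8 * CD ^ 2 * C + 1`
is `p - 1` from the chain length and `1` from the overlap; `CD ^ 4` is `CD ^ 3` from the overlap and
`CD` from moving the centre of the kernel. -/
theorem LipPoincare.pointwiseEstimate_of_eqOn_ball (hP : LipPoincare m p C Λ)
    (hm : IsMetricMeasureSpace m) (hd : IsDoubling m CD) (hCD : 1 ≤ CD) (hp : 1 ≤ p)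
    (hΛ : 1 ≤ Λ) {f : X → ℝ} {K : ℝ≥0} (hf : LipschitzWith K f) {x y : X} (hxy : x ≠ y) {ρ : ℝ}
    (hρ : 0 < ρ) (hfx : ∀ w ∈ ball x ρ, f w = f x) (hfy : ∀ w ∈ ball y ρ, f w = f y) :
    PointwiseEstimate m p
      ((8 * CD ^ 6 * C) ^ p * (8 * CD ^ 2 * C + 1) ^ p * CD ^ 4)
      (2 * ((8 * CD ^ 2 * C : ℝ≥0) : ℝ) + 4) f (lip f) x y := by
  have hp0 : 0 < p := by linarith
  have hd0 : 0 < dist x y := dist_pos.2 hxy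
  have hΛ0 : 0 < 40 * Λ := by positivity
  set C₀ : ℝ≥0 := 8 * CD ^ 2 * C with hC₀def
  set L : ℝ := 2 * C₀ + 4 with hL
  -- The floor `τ` keeps the radii positive at the poles. It matters only where the distance to a
  -- pole is below `ρ / 2`, and there `f` is constant.
  set τ := min ρ (dist x y) / 2 with hτ
  have hτ0 : 0 < τ := by positivity
  have hτρ : τ ≤ ρ / 2 := by rw [hτ]; gcongr; exact min_le_left _ _
  have hτd : τ ≤ dist x y / 2 := by rw [hτ]; gcongr; exact min_le_right _ _
  set D : X → ℝ := fun z => min (dist x z) (dist y z) with hD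
  set R : X → ℝ := fun z => max (D z) τ with hRdef
  have hRτ : ∀ z, τ ≤ R z := fun z => le_max_right _ _
  have hR : ∀ z, 0 < R z := fun z => hτ0.trans_le (hRτ z)
  have hRL : ∀ z w, R z ≤ R w + dist z w := by
    intro z w
    have h1 : D w ≤ R w := le_max_left _ _
    refine max_le ?_ (by linarith [hRτ w, dist_nonneg (x := z) (y := w)])
    have h2 := dist_triangle_right x z w
    have h3 := dist_triangle_right y z w
    rcases min_choice (dist x w) (dist y w) with h | h
    · have : D z ≤ dist x z := min_le_left _ _
      have hw : D w = dist x w := h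
      linarith
    · have : D z ≤ dist y z := min_le_right _ _
      have hw : D w = dist y w := h
      linarith
  set δ := τ / (40 * Λ) with hδdef
  have hδ0 : 0 < δ := div_pos hτ0 hΛ0
  have hδ : ∀ z, δ ≤ R z / (40 * Λ) := fun z => by rw [hδdef]; gcongr; exact hRτ z
  have hδτ : δ ≤ τ / 40 := div_le_div_of_nonneg_left hτ0.le (by norm_num) (by linarith)
  have hchain : ∀ z w : X, chainDist δ z w ≤ C₀ * edist z w := by
    intro z w
    have := hP.chainDist_le hm hd hCD hp hδ0 z w
    rw [hC₀def]
    push_cast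
    exact this
  have hfin : chainDist δ x y ≠ ⊤ := by
    have := edist_ne_top x y
    exact ((hchain x y).trans_lt (by finiteness)).ne
  obtain ⟨N, q, hq, hq0, hqN, hqmin⟩ := exists_almost_minimizing_chain hfin
    (η := ENNReal.ofReal τ) (by simpa using hτ0)
  -- This close to a pole `w` the floor must be active, so the small ball about `z` lies where `f`
  -- is constant.
  have hsmall : ∀ z w, dist z w < R z / (40 * Λ) → D z ≤ dist z w → R z = τ := by
    intro z w h1 h2
    rcases max_choice (D z) τ with h | h
    · have hz : R z = D z := h
      have h3 : R z / (40 * Λ) ≤ R z / 40 :=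
        div_le_div_of_nonneg_left (hR z).le (by norm_num) (by linarith)
      linarith [hR z]
    · exact h
  have hend : ∀ z, dist z (q N) < R z / (40 * Λ) →
      ⨍ v in ball z (R z / (40 * Λ)), f v ∂m = f y := by
    intro z hz
    rw [hqN] at hz
    have hRz := hsmall z y hz (by rw [dist_comm]; exact min_le_right _ _)
    refine average_eq_of_eqOn_ball hm hd hf (div_pos (hR z) hΛ0) fun v hv => hfy v ?_
    rw [hRz] at hv hz
    refine ball_subset_ball' ?_ hv
    linarith
  have htel := hP.edist_average_le_sum hm hd hCD hp hΛ hf hR hRL hδ hq hend N 0 (by omega)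
  have hstart : ⨍ v in ball (q 0) (R (q 0) / (40 * Λ)), f v ∂m = f x := by
    rw [hq0]
    have hDx : D x = 0 := by
      have : D x ≤ dist x x := min_le_left _ _
      rw [dist_self] at this
      exact le_antisymm this (le_min dist_nonneg dist_nonneg)
    have hRx : R x = τ := by
      have : R x = max (D x) τ := rfl
      rw [this, hDx, max_eq_right hτ0.le]
    refine average_eq_of_eqOn_ball hm hd hf (div_pos (hR x) hΛ0) fun v hv => hfx v ?_
    rw [hRx] at hv
    exact ball_subset_ball (by linarith) hv
  rw [hstart, ← Finset.range_eq_Ico] at htel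
  set g : X → ℝ≥0∞ := fun z => lip f z ^ p with hg
  have hgm : Measurable g := (measurable_lip hf.continuous).pow_const p
  have hlen : ∑ i ∈ Finset.range N, edist (q i) (q (i + 1)) ≤ (C₀ + 1) * edist x y := by
    have h := hqmin 0 N (Nat.zero_le _) le_rfl
    rw [hq0, hqN, ← Finset.range_eq_Ico] at h
    calc _ ≤ C₀ * edist x y + edist x y := by
          refine h.trans (add_le_add (hchain x y) ?_)
          rw [edist_dist]
          exact ENNReal.ofReal_le_ofReal (by linarith)
      _ = _ := by ring
  have hnear : ∀ i ≤ N, dist x (q i) ≤ (C₀ + 1) * dist x y := by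
    intro i hi
    have h : edist (q 0) (q i) ≤ (C₀ + 1) * edist x y :=
      ((edist_le_range_sum_edist q i).trans
        (Finset.sum_le_sum_of_subset (Finset.range_mono hi))).trans hlen
    rw [hq0, edist_dist, edist_dist, ← ENNReal.ofReal_coe_nnreal, ← ENNReal.ofReal_one,
      ← ENNReal.ofReal_add (by positivity) (by norm_num), ← ENNReal.ofReal_mul (by positivity)] at h
    exact (ENNReal.ofReal_le_ofReal_iff (by positivity)).1 h
  -- Within `ρ` of a pole both sides vanish because `lip f = 0`; elsewhere `R z` is the true
  -- distance to the nearer pole.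
  have hpt : ∀ z, (∑ i ∈ Finset.range N, edist (q i) (q (i + 1)) *
      ((m (ball (q i) (R (q i) / 4)))⁻¹ * (ball (q i) (R (q i) / 4)).indicator 1 z)) * g z ≤
      CD ^ 4 * (C₀ + 1) * (riesz m L x y z * g z) := by
    intro z
    by_cases hz : z ∈ ball x ρ ∪ ball y ρ
    · have : lip f z = 0 := by
        rcases hz with hz | hz
        · exact lip_eq_zero_of_eqOn_ball hz hfx
        · exact lip_eq_zero_of_eqOn_ball hz hfy
      have hgz : g z = 0 := by rw [hg]; simp only [this]; exact ENNReal.zero_rpow_of_pos hp0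
      rw [hgz, mul_zero, mul_zero, mul_zero]
    rw [Set.mem_union, not_or, mem_ball', mem_ball', not_lt, not_lt] at hz
    have hDz : ρ ≤ D z := le_min hz.1 hz.2
    have hRz : R z = D z := max_eq_left (by linarith)
    have hzx : z ≠ x := by
      rintro rfl
      rw [dist_self] at hz
      linarith [hz.1]
    have hzy : z ≠ y := by
      rintro rfl
      rw [dist_self] at hz
      linarith [hz.2]
    by_cases hex : ∃ i ∈ Finset.range N, z ∈ ball (q i) (R (q i) / 4)
    · obtain ⟨i, hi, hzi⟩ := hex
      have hmem : z ∈ ball x (L * dist x y) ∪ ball y (L * dist x y) := by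
        left
        have h1 := hnear i (Finset.mem_range.1 hi).le
        have h2 : R (q i) ≤ dist x (q i) + τ :=
          max_le ((min_le_left _ _).trans (by linarith)) (by linarith [dist_nonneg (x := x) (y := q i)])
        have h3 := dist_triangle z (q i) x
        rw [dist_comm (q i) x] at h3
        rw [mem_ball] at hzi ⊢
        have h4 : (0 : ℝ) ≤ C₀ * dist x y := by positivity
        rw [hL]
        nlinarith
      have h1 := sum_indicator_ball_le hd hCD hR hRL hchain hq hqmin z
        (by linarith [hRτ z]) (ENNReal.ofReal_le_ofReal (hRτ z))
      have h2 := ofReal_min_dist_div_le hd hCD hzx hzy hmem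
      rw [← mul_assoc]
      gcongr
      refine h1.trans ?_
      rw [hRz]
      calc _ ≤ (CD : ℝ≥0∞) ^ 3 * (C₀ + 1) * (CD * riesz m L x y z) := by gcongr
        _ = _ := by ring
    · push Not at hex
      rw [Finset.sum_eq_zero fun i hi => by rw [Set.indicator_of_notMem (hex i hi)]; simp, zero_mul]
      exact bot_le
  have hint : ∑ i ∈ Finset.range N, edist (q i) (q (i + 1)) *
      ⨍⁻ v in ball (q i) (R (q i) / 4), g v ∂m ≤
      CD ^ 4 * (C₀ + 1) * ∫⁻ z, g z ∂(rieszMeasure m L x y) := by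
    rw [lintegral_rieszMeasure hm L x y hgm]
    refine le_trans (le_of_eq ?_) ((lintegral_mono hpt).trans
      (lintegral_const_mul _ ((measurable_riesz hm L x y).mul hgm)).le)
    have e : ∀ i z, edist (q i) (q (i + 1)) * ((m (ball (q i) (R (q i) / 4)))⁻¹ *
        (ball (q i) (R (q i) / 4)).indicator 1 z) * g z =
        edist (q i) (q (i + 1)) * (m (ball (q i) (R (q i) / 4)))⁻¹ *
          (ball (q i) (R (q i) / 4)).indicator g z := by
      intro i z
      by_cases hz : z ∈ ball (q i) (R (q i) / 4)
      · simp only [Set.indicator_of_mem hz, Pi.one_apply]; ring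
      · simp only [Set.indicator_of_notMem hz]; ring
    simp only [Finset.sum_mul, e]
    rw [lintegral_finsetSum _ fun i _ => (hgm.indicator measurableSet_ball).const_mul _]
    refine Finset.sum_congr rfl fun i _ => ?_
    rw [lintegral_const_mul _ (hgm.indicator measurableSet_ball),
      lintegral_indicator measurableSet_ball, setLAverage_eq, div_eq_mul_inv]
    ring
  rw [PointwiseEstimate, ofReal_abs_sub_eq_edist]
  calc edist (f x) (f y) ^ p
      ≤ (8 * CD ^ 6 * C * ∑ i ∈ Finset.range N, edist (q i) (q (i + 1)) *
        (⨍⁻ v in ball (q i) (R (q i) / 4), g v ∂m) ^ (1 / p)) ^ p := by gcongr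
    _ ≤ (8 * CD ^ 6 * C) ^ p * (((C₀ + 1) * edist x y) ^ (p - 1) *
        (CD ^ 4 * (C₀ + 1) * ∫⁻ z, g z ∂(rieszMeasure m L x y))) := by
        rw [ENNReal.mul_rpow_of_nonneg _ _ hp0.le]
        gcongr
        refine (sum_mul_rpow_le _ hp _ _).trans ?_
        gcongr
    _ = _ := by
        have e1 : ((C₀ : ℝ≥0∞) + 1) ^ p = (C₀ + 1) ^ (p - 1) * (C₀ + 1) := by
          conv_lhs => rw [show p = (p - 1) + 1 by ring]
          rw [ENNReal.rpow_add_of_nonneg _ _ (by linarith) (by norm_num), ENNReal.rpow_one]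
        rw [ENNReal.mul_rpow_of_nonneg _ _ (by linarith : 0 ≤ p - 1)]
        push_cast
        rw [ENNReal.coe_rpow_of_nonneg _ hp0.le, ENNReal.coe_rpow_of_nonneg _ hp0.le]
        push_cast
        rw [e1]
        ring

end LocallyConstant

/-! ### From local gradients to Lipschitz functions -/

section LocalGradient

variable {X : Type u} [MetricSpace X]

/-- `g` is, up to the factor `2`, a Hajłasz gradient of `u` at scales at most `ε`. -/
def IsLocalGradient (ε : ℝ) (u : X → ℝ) (g : X → ℝ≥0∞) : Prop :=
  ∀ z w, dist z w ≤ ε → edist (u z) (u w) ≤ (g z + g w) * edist z w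

/-- Each `w` near `z` has a point `w'` of the sublevel set at distance `o(dist w z)`. From `w` to
`w'` the Lipschitz bound costs a vanishing fraction; from `w'` to `z` the gradient bound gives slope
`2 * t`. -/
theorem lip_le_of_eventually_nonempty {ε : ℝ} (hε : 0 < ε) {v f : X → ℝ} {G : X → ℝ≥0∞}
    (hv : IsLocalGradient ε v G) {K : ℝ≥0} (hf : LipschitzWith K f) {t : ℝ≥0}
    (hfv : ∀ w, G w ≤ t → f w = v w) {z : X} (hz : G z ≤ t)
    (h : ∀ n : ℕ, ∀ᶠ w in 𝓝[≠] z,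
      ({w | G w ≤ t} ∩ closedBall w (1 / (n + 1) * dist w z)).Nonempty) :
    lip f z ≤ 2 * t := by
  have hn : ∀ n : ℕ, lip f z ≤ 2 * t + (K + 2 * t) * ENNReal.ofReal (1 / (n + 1)) := by
    intro n
    obtain ⟨s, hs, hsub⟩ := Metric.eventually_nhds_iff.1 (eventually_nhdsWithin_iff.1 (h n))
    have hs' : 0 < min s (ε / 2) := by positivity
    refine (lip_le_slope f hs' z).trans (slope_le fun w hw => ?_)
    rcases eq_or_ne w z with rfl | hwz
    · simp
    obtain ⟨w', hw't, hw'⟩ := hsub (hw.trans_le (min_le_left _ _)) hwz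
    have hn1 : (1 : ℝ) / (n + 1) ≤ 1 := by
      rw [div_le_one (by positivity)]
      linarith [(Nat.cast_nonneg n : (0 : ℝ) ≤ n)]
    have h1 : edist w' w ≤ ENNReal.ofReal (1 / (n + 1)) * edist w z := by
      rw [edist_dist, edist_dist, ← ENNReal.ofReal_mul (by positivity)]
      exact ENNReal.ofReal_le_ofReal hw'
    have h2 : dist w' z ≤ ε := by
      have h3 : 1 / ((n : ℝ) + 1) * dist w z ≤ 1 * dist w z := by gcongr
      have h4 := dist_triangle w' w z
      have h5 := hw.trans_le (min_le_right _ _)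
      rw [mem_closedBall] at hw'
      linarith
    calc edist (f w) (f z) ≤ edist (f w) (f w') + edist (f w') (f z) := edist_triangle _ _ _
      _ ≤ K * edist w' w + (G w' + G z) * edist w' z := by
          rw [edist_comm w' w]
          refine add_le_add (hf w w') ?_
          rw [hfv w' hw't, hfv z hz]
          exact hv w' z h2
      _ ≤ K * edist w' w + (t + t) * (edist w' w + edist w z) := by
          gcongr
          · exact hw't
          · exact edist_triangle _ _ _
      _ ≤ K * (ENNReal.ofReal (1 / (n + 1)) * edist w z) +
          (t + t) * (ENNReal.ofReal (1 / (n + 1)) * edist w z + edist w z) := by gcongr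
      _ = _ := by ring
  have hlim : Tendsto (fun n : ℕ => 2 * (t : ℝ≥0∞) + (K + 2 * t) *
      ENNReal.ofReal (1 / ((n : ℝ) + 1))) atTop (𝓝 (2 * t + (K + 2 * t) * ENNReal.ofReal 0)) :=
    tendsto_const_nhds.add (ENNReal.Tendsto.const_mul
      (ENNReal.tendsto_ofReal tendsto_one_div_add_atTop_nhds_zero_nat) (Or.inr (by finiteness)))
  rw [ENNReal.ofReal_zero, mul_zero, add_zero] at hlim
  exact ge_of_tendsto' hlim hn

variable [MeasurableSpace X] [BorelSpace X] {m : Measure X} {CD : ℝ≥0}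

theorem IsDoubling.isUnifLocDoublingMeasure (hd : IsDoubling m CD) :
    IsUnifLocDoublingMeasure m := by
  refine ⟨CD ^ 2, ?_⟩
  filter_upwards [self_mem_nhdsWithin] with ε hε x
  rw [Set.mem_Ioi] at hε
  calc m (closedBall x (2 * ε)) ≤ m (ball x (2 ^ 2 * ε)) :=
        measure_mono (closedBall_subset_ball (by linarith))
    _ ≤ CD ^ 2 * m (ball x ε) := hd.measure_ball_pow_le x hε 2
    _ ≤ _ := by
        push_cast
        gcongr
        exact ball_subset_closedBall

/-- Where `G z ≥ s` the global Lipschitz constant suffices. Elsewhere `z` is almost surely a density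
point of every rational sublevel set containing it, and a rational level just above `G z` is used.
-/
theorem ae_lip_le_of_isLocalGradient (hm : IsMetricMeasureSpace m) (hd : IsDoubling m CD) {ε : ℝ}
    (hε : 0 < ε) {v f : X → ℝ} {G : X → ℝ≥0∞} (hG : Measurable G) (hv : IsLocalGradient ε v G)
    {s : ℝ≥0} (hf : LipschitzWith (2 * s) f) (hfv : ∀ w, G w ≤ s → f w = v w) :
    ∀ᵐ z ∂m, lip f z ≤ 2 * G z := by
  have := hm.secondCountableTopology
  have := hm.isLocallyFiniteMeasure
  have := hd.isUnifLocDoublingMeasure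
  have hae : ∀ᵐ z ∂m, ∀ (t : ℚ) (n : ℕ), G z ≤ ((t : ℝ).toNNReal : ℝ≥0∞) →
      ∀ᶠ w in 𝓝[≠] z, ({w | G w ≤ ((t : ℝ).toNNReal : ℝ≥0∞)} ∩
        closedBall w (1 / (n + 1) * dist w z)).Nonempty := by
    refine ae_all_iff.2 fun t => ae_all_iff.2 fun n => ?_
    have hS : MeasurableSet {w | G w ≤ ((t : ℝ).toNNReal : ℝ≥0∞)} := hG measurableSet_Iic
    refine (ae_restrict_iff' hS).1 ?_
    filter_upwards [IsUnifLocDoublingMeasure.ae_tendsto_measure_inter_div m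
      {w | G w ≤ ((t : ℝ).toNNReal : ℝ≥0∞)} (n + 1)] with z hz
    have htend : Tendsto (fun w => 1 / ((n : ℝ) + 1) * dist w z) (𝓝[≠] z) (𝓝[>] 0) := by
      refine tendsto_nhdsWithin_iff.2 ⟨?_, ?_⟩
      · have : Tendsto (fun w => 1 / ((n : ℝ) + 1) * dist w z) (𝓝 z)
            (𝓝 (1 / ((n : ℝ) + 1) * dist z z)) :=
          (continuous_const.mul (continuous_id.dist continuous_const)).tendsto z
        rw [dist_self, mul_zero] at this
        exact this.mono_left nhdsWithin_le_nhds
      · filter_upwards [self_mem_nhdsWithin] with w hw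
        have : 0 < dist w z := dist_pos.2 hw
        rw [Set.mem_Ioi]
        positivity
    -- The density theorem is applied to balls centred at `w`, which need contain `z` only after
    -- dilation by `n + 1`; density tending to one makes them meet the set.
    have h1 := hz (fun w : X => w) _ htend (Eventually.of_forall fun w => by
      rw [mem_closedBall, dist_comm z w, ← mul_assoc, mul_one_div_cancel (by positivity), one_mul])
    filter_upwards [h1.eventually_ne one_ne_zero] with w hw
    by_contra hcon
    rw [Set.not_nonempty_iff_eq_empty] at hcon
    rw [hcon] at hw
    simp at hw
  filter_upwards [hae] with z hz
  rcases le_or_gt (s : ℝ≥0∞) (G z) with hs | hs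
  · refine (lip_le_of_lipschitzWith hf z).trans ?_
    push_cast
    gcongr
  · by_contra! hcon
    have hlt : G z < min (lip f z / 2) s := by
      refine lt_min ?_ hs
      rwa [ENNReal.lt_div_iff_mul_lt (by simp) (by simp), mul_comm]
    obtain ⟨t, _, ht1, ht2⟩ := ENNReal.lt_iff_exists_rat_btwn.1 hlt
    have ht3 : ((t : ℝ).toNNReal : ℝ≥0∞) < s := ht2.trans_le (min_le_right _ _)
    have ht4 := ht2.trans_le (min_le_left _ _)
    rw [ENNReal.lt_div_iff_mul_lt (by simp) (by simp), mul_comm] at ht4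
    exact absurd (lip_le_of_eventually_nonempty hε hv hf
      (fun w hw => hfv w (hw.trans ht3.le)) ht1.le fun n => hz t n ht1.le) (not_le.2 ht4)

theorem LipPoincare.edist_rpow_le_of_isLocalGradient {C : ℝ≥0} {p Λ : ℝ}
    (hP : LipPoincare m p C Λ) (hm : IsMetricMeasureSpace m) (hd : IsDoubling m CD)
    (hCD : 1 ≤ CD) (hp : 1 ≤ p) (hΛ : 1 ≤ Λ) {ε ρ : ℝ} (hε : 0 < ε) (hρ : 0 < ρ) {v : X → ℝ}
    {G : X → ℝ≥0∞} (hG : Measurable G) (hv : IsLocalGradient ε v G) {x y : X} (hxy : x ≠ y)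
    (hx : ∀ w ∈ ball x ρ, v w = v x ∧ G w = 0) (hy : ∀ w ∈ ball y ρ, v w = v y ∧ G w = 0) :
    edist (v x) (v y) ^ p ≤
      ((8 * CD ^ 6 * C) ^ p * (8 * CD ^ 2 * C + 1) ^ p * CD ^ 4 : ℝ≥0) * edist x y ^ (p - 1) *
      (2 ^ p * ∫⁻ z, G z ^ p ∂(rieszMeasure m (2 * ((8 * CD ^ 2 * C : ℝ≥0) : ℝ) + 4) x y)) := by
  have hp0 : 0 < p := by linarith
  set M := |v x| + |v y| with hM
  have hM0 : 0 ≤ M := by positivity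
  set v' : X → ℝ := fun z => max (min (v z) M) (-M)
  have hv'M : ∀ z, -M ≤ v' z ∧ v' z ≤ M := fun z =>
    ⟨le_max_right _ _, max_le (min_le_right _ _) (by linarith)⟩
  have hv'v : ∀ z, |v z| ≤ M → v' z = v z := fun z hz => by
    have := abs_le.1 hz
    simp only [v']
    rw [min_eq_left this.2, max_eq_left this.1]
  have hvx : v' x = v x := hv'v x (by rw [hM]; linarith [abs_nonneg (v y)])
  have hvy : v' y = v y := hv'v y (by rw [hM]; linarith [abs_nonneg (v x)])
  have hv' : IsLocalGradient ε v' G := by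
    intro z w hzw
    refine le_trans ?_ (hv z w hzw)
    rw [edist_dist, edist_dist, Real.dist_eq, Real.dist_eq]
    refine ENNReal.ofReal_le_ofReal ?_
    exact (abs_max_sub_max_le_abs _ _ _).trans 
      ((abs_min_sub_min_le_max _ _ _ _).trans (by simp))
  -- At this level one constant serves all pairs in the sublevel set: up to distance `ε` by the
  -- gradient, beyond it because the truncated function oscillates by at most `2 * M`.
  set s : ℝ≥0 := (M / ε).toNNReal with hs
  have hLip : LipschitzOnWith (2 * s) v' {w | G w ≤ s} := by
    intro z hz w hw
    rcases le_or_gt (dist z w) ε with h | h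
    · refine (hv' z w h).trans ?_
      rw [ENNReal.coe_mul, ENNReal.coe_ofNat, two_mul]
      gcongr
      · exact hz
      · exact hw
    · rw [edist_dist, edist_dist, ← ENNReal.ofReal_coe_nnreal, ← ENNReal.ofReal_mul (by positivity)]
      refine ENNReal.ofReal_le_ofReal ?_
      rw [NNReal.coe_mul, hs, Real.coe_toNNReal _ (by positivity), NNReal.coe_ofNat]
      have h1 : dist (v' z) (v' w) ≤ 2 * M := by
        rw [Real.dist_eq, abs_sub_le_iff]
        constructor <;> linarith [hv'M z, hv'M w]
      have h2 : M ≤ M / ε * dist z w := by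
        rw [div_mul_eq_mul_div, le_div_iff₀ hε]
        gcongr
      linarith
  obtain ⟨f, hf, hfv⟩ := hLip.extend_real
  have hfv' : ∀ w, G w ≤ s → f w = v' w := fun w hw => (hfv hw).symm
  have hconst : ∀ a : X, (∀ w ∈ ball a ρ, v w = v a ∧ G w = 0) → ∀ w ∈ ball a ρ, f w = v' a := by
    intro a ha w hw
    rw [hfv' w (by rw [(ha w hw).2]; exact bot_le)]
    simp only [v']
    rw [(ha w hw).1]
  have hfx := hconst x hx x (mem_ball_self hρ)
  have hfy := hconst y hy y (mem_ball_self hρ)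
  have h := hP.pointwiseEstimate_of_eqOn_ball hm hd hCD hp hΛ hf hxy hρ
    (fun w hw => by rw [hfx]; exact hconst x hx w hw)
    (fun w hw => by rw [hfy]; exact hconst y hy w hw)
  rw [PointwiseEstimate, ofReal_abs_sub_eq_edist, hfx, hfy, hvx, hvy] at h
  refine h.trans ?_
  gcongr
  rw [← lintegral_const_mul _ (hG.pow_const p)]
  refine lintegral_mono_ae ?_
  have hae := ae_lip_le_of_isLocalGradient hm hd hε hG hv' hf hfv'
  filter_upwards [(withDensity_absolutelyContinuous m _).ae_le hae] with z hz
  rw [← ENNReal.mul_rpow_of_nonneg _ _ hp0.le]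
  gcongr

end LocalGradient

/-! ### Making a function constant near a pole -/

section Flattening

variable {X : Type u} [MetricSpace X]

/-- The asymmetric form matters: for `s = 1` the term with `edist a b` vanishes and only `b` is
compared with `c`. -/
theorem edist_convex_combination_le {s t : ℝ} (hs : s ∈ Set.Icc (0 : ℝ) 1) (a b c : ℝ) :
    edist ((1 - s) * a + s * c) ((1 - t) * b + t * c) ≤
      ENNReal.ofReal (1 - s) * edist a b + ENNReal.ofReal |s - t| * edist b c := by
  rw [edist_dist, edist_dist a, edist_dist b, ← ENNReal.ofReal_mul (by linarith [hs.2]),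
    ← ENNReal.ofReal_mul (abs_nonneg _),
    ← ENNReal.ofReal_add (mul_nonneg (by linarith [hs.2]) dist_nonneg) (by positivity)]
  refine ENNReal.ofReal_le_ofReal ?_
  simp only [Real.dist_eq]
  calc |(1 - s) * a + s * c - ((1 - t) * b + t * c)|
      = |(1 - s) * (a - b) + -((s - t) * (b - c))| := by congr 1; ring
    _ ≤ |(1 - s) * (a - b)| + |-((s - t) * (b - c))| := abs_add_le _ _
    _ = _ := by rw [abs_neg, abs_mul, abs_mul, abs_of_nonneg (by linarith [hs.2] : 0 ≤ 1 - s)]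

/-- A cutoff function around `a`. -/
noncomputable def cutoff (a : X) (ρ : ℝ) (w : X) : ℝ :=
  max 0 (min 1 (2 - dist a w / ρ))

theorem cutoff_mem_Icc (a : X) (ρ : ℝ) (w : X) : cutoff a ρ w ∈ Set.Icc (0 : ℝ) 1 :=
  ⟨le_max_left _ _, max_le zero_le_one (min_le_left _ _)⟩

theorem cutoff_eq_one {a w : X} {ρ : ℝ} (hρ : 0 < ρ) (h : dist a w < ρ) : cutoff a ρ w = 1 := by
  have : dist a w / ρ ≤ 1 := (div_le_one hρ).2 h.le
  rw [cutoff, min_eq_left (by linarith), max_eq_right zero_le_one]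

theorem cutoff_eq_zero {a w : X} {ρ : ℝ} (hρ : 0 < ρ) (h : 2 * ρ ≤ dist a w) :
    cutoff a ρ w = 0 := by
  have : 2 ≤ dist a w / ρ := (le_div_iff₀ hρ).2 h
  exact max_eq_left ((min_le_right _ _).trans (by linarith))

theorem abs_cutoff_sub_le {ρ : ℝ} (hρ : 0 < ρ) (a z w : X) :
    |cutoff a ρ z - cutoff a ρ w| ≤ dist z w / ρ := by
  have h1 : |cutoff a ρ z - cutoff a ρ w| ≤ |(2 - dist a z / ρ) - (2 - dist a w / ρ)| := by
    simp only [cutoff]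
    rw [max_comm 0, max_comm 0]
    refine (abs_max_sub_max_le_abs _ _ _).trans ?_
    exact (abs_min_sub_min_le_max _ _ _ _).trans (by simp)
  refine h1.trans ?_
  rw [show (2 - dist a z / ρ) - (2 - dist a w / ρ) = (dist a w - dist a z) / ρ by ring, abs_div,
    abs_of_pos hρ]
  gcongr
  rw [dist_comm z w, dist_comm a w, dist_comm a z]
  exact abs_dist_sub_le w z a

/-- The function `u` with the values near `a` replaced by the constant `c`. -/
noncomputable def flatten (u : X → ℝ) (a : X) (ρ c : ℝ) (w : X) : ℝ :=
  (1 - cutoff a ρ w) * u w + cutoff a ρ w * c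

/-- The local gradient of a flattened function. -/
noncomputable def flattenGradient (g : X → ℝ≥0∞) (a : X) (ρ : ℝ) (α : ℝ≥0∞) : X → ℝ≥0∞ :=
  (ball a ρ)ᶜ.indicator fun w => 6 * (g w + (ball a (2 * ρ)).indicator (fun _ => α) w)

theorem flatten_eq_const {u : X → ℝ} {a w : X} {ρ c : ℝ} (hρ : 0 < ρ) (h : dist a w < ρ) :
    flatten u a ρ c w = c := by
  rw [flatten, cutoff_eq_one hρ h]; ring

theorem flatten_eq_self {u : X → ℝ} {a w : X} {ρ c : ℝ} (hρ : 0 < ρ) (h : 2 * ρ ≤ dist a w) :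
    flatten u a ρ c w = u w := by
  rw [flatten, cutoff_eq_zero hρ h]; ring

/-- Only the endpoint farther from `a` is compared with `c`. So the gradient may vanish on the inner
ball, even for pairs with one point inside and one outside. -/
theorem isLocalGradient_flatten {u : X → ℝ} {g : X → ℝ≥0∞} {ρ ε c : ℝ} (hρ : 0 < ρ) (hρε : ρ ≤ ε)
    (hu : IsLocalGradient ε u g) {a : X} {α : ℝ≥0∞}
    (hc : ∀ w, dist a w < 3 * ρ → edist (u w) c ≤ (g w + α) * ENNReal.ofReal (5 * ρ)) :
    IsLocalGradient ρ (flatten u a ρ c) (flattenGradient g a ρ α) := by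
  have hG : ∀ w, ρ ≤ dist a w → 6 * g w ≤ flattenGradient g a ρ α w := fun w hw => by
    rw [flattenGradient, Set.indicator_of_mem (by
      rw [Set.mem_compl_iff, mem_ball', not_lt]; exact hw)]
    gcongr
    exact le_self_add
  have hG2 : ∀ w, ρ ≤ dist a w → dist a w < 2 * ρ → flattenGradient g a ρ α w = 6 * (g w + α) :=
    fun w hw hw2 => by
      rw [flattenGradient, Set.indicator_of_mem (by
        rw [Set.mem_compl_iff, mem_ball', not_lt]; exact hw),
        Set.indicator_of_mem (by rwa [mem_ball'])]
  have key : ∀ z w, dist z w ≤ ρ → dist a z ≤ dist a w →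
      edist (flatten u a ρ c z) (flatten u a ρ c w) ≤
        (flattenGradient g a ρ α z + flattenGradient g a ρ α w) * edist z w := by
    intro z w hzw haz
    rcases lt_or_ge (dist a w) ρ with hw | hw
    · rw [flatten_eq_const hρ hw, flatten_eq_const hρ (haz.trans_lt hw), edist_self]
      exact bot_le
    rcases le_or_gt (2 * ρ) (dist a z) with hz | hz
    · rw [flatten_eq_self hρ hz, flatten_eq_self hρ (hz.trans haz)]
      refine (hu z w (hzw.trans hρε)).trans ?_
      gcongr
      · exact (le_mul_of_one_le_left' (by norm_num)).trans (hG z (by linarith))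
      · exact (le_mul_of_one_le_left' (by norm_num)).trans (hG w hw)
    have htri := dist_triangle a z w
    have h1 : ENNReal.ofReal |cutoff a ρ z - cutoff a ρ w| * edist (u w) c ≤
        5 * (g w + α) * edist z w := by
      calc _ ≤ ENNReal.ofReal (dist z w / ρ) * ((g w + α) * ENNReal.ofReal (5 * ρ)) := by
            gcongr
            · exact abs_cutoff_sub_le hρ a z w
            · exact hc w (by linarith)
        _ = (g w + α) * ENNReal.ofReal (dist z w / ρ * (5 * ρ)) := by
            rw [ENNReal.ofReal_mul (p := dist z w / ρ) (by positivity)]; ring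
        _ = (g w + α) * (5 * edist z w) := by
            rw [show dist z w / ρ * (5 * ρ) = 5 * dist z w by field_simp,
              ENNReal.ofReal_mul (by norm_num), ENNReal.ofReal_ofNat, edist_dist]
        _ = _ := by ring
    refine (edist_convex_combination_le (cutoff_mem_Icc a ρ z) (u z) (u w) c).trans ?_
    rcases lt_or_ge (dist a z) ρ with hz1 | hz1
    · rw [cutoff_eq_one hρ hz1, sub_self, ENNReal.ofReal_zero, zero_mul, zero_add,
        ← cutoff_eq_one hρ hz1]
      refine h1.trans ?_
      rw [hG2 w hw (by linarith)]
      refine mul_le_mul_left ?_ _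
      refine le_trans ?_ le_add_self
      gcongr
      norm_num
    · rw [hG2 z hz1 hz]
      calc _ ≤ 1 * ((g z + g w) * edist z w) + 5 * (g w + α) * edist z w := by
            refine add_le_add (mul_le_mul' ?_ (hu z w (hzw.trans hρε))) h1
            rw [← ENNReal.ofReal_one]
            exact ENNReal.ofReal_le_ofReal (by linarith [(cutoff_mem_Icc a ρ z).1])
        _ = (1 * g z + 5 * α + 6 * g w) * edist z w := by ring
        _ ≤ (6 * g z + 6 * α + flattenGradient g a ρ α w) * edist z w := by
            gcongr
            · norm_num
            · norm_num
            · exact hG w hw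
        _ = _ := by ring
  intro z w hzw
  rcases le_total (dist a z) (dist a w) with h | h
  · exact key z w hzw h
  · rw [edist_comm, edist_comm z w, add_comm]
    exact key w z (by rwa [dist_comm]) h

variable [MeasurableSpace X] [BorelSpace X] {m : Measure X} {CD : ℝ≥0}

/-- The ball of radius `ρ / 4` about `z` lies in the annulus. -/
theorem measure_ball_le_annulus (hd : IsDoubling m CD) {a z : X} {ρ : ℝ} (hρ : 0 < ρ)
    (hz1 : 5 / 4 * ρ < dist a z) (hz2 : dist a z < 7 / 4 * ρ) :
    m (ball a (2 * ρ)) ≤ CD ^ 4 * m (ball a (2 * ρ) \ ball a ρ) := by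
  refine (hd.measure_ball_le (x := z) (y := a) (r := ρ / 4) (by positivity) 4
    (by linarith)).trans ?_
  gcongr
  intro w hw
  rw [mem_ball'] at hw
  have h1 := dist_triangle a z w
  have h2 := dist_triangle a w z
  rw [dist_comm w z] at h2
  refine ⟨by rw [mem_ball']; linarith, by rw [mem_ball', not_lt]; linarith⟩

/-- The integral over the annulus is the difference of those over the two balls. Hence convergence
of ball averages suffices, without the `L^1` form of the Lebesgue point condition. -/
theorem abs_average_annulus_sub_le {u : X → ℝ} {a : X} {ρ θ b : ℝ} {K : ℝ≥0}
    (hu : IntegrableOn u (ball a (2 * ρ)) m) (hfin : m (ball a (2 * ρ)) ≠ ⊤) (hρ : 0 < ρ)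
    (hA : m (ball a (2 * ρ) \ ball a ρ) ≠ 0)
    (hK : m (ball a (2 * ρ)) ≤ K * m (ball a (2 * ρ) \ ball a ρ))
    (h1 : |(⨍ w in ball a ρ, u w ∂m) - b| ≤ θ) (h2 : |(⨍ w in ball a (2 * ρ), u w ∂m) - b| ≤ θ) :
    |(⨍ w in ball a (2 * ρ) \ ball a ρ, u w ∂m) - b| ≤ 2 * K * θ := by
  set B := ball a ρ
  set B' := ball a (2 * ρ)
  have hsub : B ⊆ B' := ball_subset_ball (by linarith)
  have hAfin : m (B' \ B) ≠ ⊤ := measure_ne_top_of_subset Set.sdiff_subset hfin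
  have hBfin : m B ≠ ⊤ := measure_ne_top_of_subset hsub hfin
  have hmA : 0 < m.real (B' \ B) := ENNReal.toReal_pos hA hAfin
  have hKr : m.real B' ≤ K * m.real (B' \ B) := by
    have := ENNReal.toReal_mono (ENNReal.mul_ne_top ENNReal.coe_ne_top hAfin) hK
    rwa [ENNReal.toReal_mul, ENNReal.coe_toReal] at this
  have hBr : m.real B ≤ m.real B' := ENNReal.toReal_mono hfin (measure_mono hsub)
  have hθ : 0 ≤ θ := (abs_nonneg _).trans h1
  have hint : ∀ s : Set X, s ⊆ B' → m s ≠ ⊤ → ∫ w in s, u w ∂m = m.real s * ⨍ w in s, u w ∂m :=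
    fun s _ hs => by rw [← smul_eq_mul, measure_smul_setAverage u hs]
  have hdiff : ∫ w in B' \ B, u w ∂m = ∫ w in B', u w ∂m - ∫ w in B, u w ∂m :=
    setIntegral_sdiff measurableSet_ball hu hsub
  have hmeas : m.real (B' \ B) = m.real B' - m.real B :=
    measureReal_sdiff hsub measurableSet_ball
  rw [hint _ Set.sdiff_subset hAfin, hint _ le_rfl hfin, hint _ hsub hBfin] at hdiff
  set A₀ := ⨍ w in B' \ B, u w ∂m
  set A₁ := ⨍ w in B, u w ∂m
  set A₂ := ⨍ w in B', u w ∂m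
  have hid : m.real (B' \ B) * (A₀ - b) = m.real B' * (A₂ - b) - m.real B * (A₁ - b) := by
    rw [mul_sub, hdiff, hmeas]; ring
  have habs : m.real (B' \ B) * |A₀ - b| ≤ m.real (B' \ B) * (2 * K * θ) := by
    calc m.real (B' \ B) * |A₀ - b| = |m.real (B' \ B) * (A₀ - b)| := by
          rw [abs_mul, abs_of_pos hmA]
      _ ≤ |m.real B' * (A₂ - b)| + |m.real B * (A₁ - b)| := by rw [hid]; exact abs_sub _ _
      _ = m.real B' * |A₂ - b| + m.real B * |A₁ - b| := by
          rw [abs_mul, abs_mul, abs_of_nonneg measureReal_nonneg, abs_of_nonneg measureReal_nonneg]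
      _ ≤ m.real B' * θ + m.real B' * θ := by gcongr
      _ = 2 * m.real B' * θ := by ring
      _ ≤ 2 * (K * m.real (B' \ B)) * θ := by gcongr
      _ = _ := by ring
  exact le_of_mul_le_mul_left habs hmA

/-- On the annulus the distances to each pole vary by at most a factor two. This is why averages
over an annulus, rather than a ball about the pole, are used. -/
theorem riesz_le_of_mem_annulus (hd : IsDoubling m CD) (hCD : 1 ≤ CD) {L : ℝ} (hL : 1 ≤ L)
    {a b z w : X} {ρ : ℝ} (hρ : 0 < ρ) (hρd : 2 * ρ ≤ dist a b / 4)
    (hz : z ∈ ball a (2 * ρ) \ ball a ρ) (hw : w ∈ ball a (2 * ρ) \ ball a ρ) :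
    riesz m L a b z ≤ 2 * CD * riesz m L a b w := by
  have hfacts : ∀ v ∈ ball a (2 * ρ) \ ball a ρ, v ≠ a ∧ v ≠ b ∧
      v ∈ ball a (L * dist a b) ∪ ball b (L * dist a b) ∧ ρ ≤ dist a v ∧ dist a v < 2 * ρ ∧
      3 / 4 * dist a b ≤ dist b v ∧ dist b v ≤ 5 / 4 * dist a b := by
    rintro v ⟨hv1, hv2⟩
    rw [mem_ball'] at hv1 hv2
    rw [not_lt] at hv2
    have h1 := dist_triangle a v b
    have h2 := dist_triangle b a v
    rw [dist_comm v b] at h1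
    rw [dist_comm b a] at h2
    have hLd : 1 * dist a b ≤ L * dist a b := by gcongr
    refine ⟨?_, ?_, Or.inl (by rw [mem_ball']; linarith), hv2, hv1, by linarith, by linarith⟩
    · rintro rfl; rw [dist_self] at hv2; linarith
    · rintro rfl; rw [dist_self] at h1; linarith
  obtain ⟨hz1, hz2, hz3, hz4, hz5, hz6, hz7⟩ := hfacts z hz
  obtain ⟨hw1, hw2, hw3, hw4, hw5, hw6, hw7⟩ := hfacts w hw
  rw [riesz_eq hz1 hz2 hz3, riesz_eq hw1 hw2 hw3, mul_add]
  exact add_le_add (kernel_le_of_comparable hd hCD (by linarith) (by linarith))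
    (kernel_le_of_comparable hd hCD (by linarith) (by linarith))

/-- By Jensen and the near constancy of the Riesz density on the annulus, the added constant `α`
costs at most `2 * CD` times the energy of `g`. The factor `12` is `6` from the gradient and `2`
from splitting the power of a sum. -/
theorem lintegral_flattenGradient_le (hm : IsMetricMeasureSpace m) (hd : IsDoubling m CD)
    (hCD : 1 ≤ CD) {p L : ℝ} (hp : 1 ≤ p) (hL : 1 ≤ L) {a b : X} {ρ : ℝ} (hρ : 0 < ρ)
    (hρd : 2 * ρ ≤ dist a b / 4) (hA : m (ball a (2 * ρ) \ ball a ρ) ≠ 0) {g : X → ℝ≥0∞}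
    (hg : Measurable g) :
    ∫⁻ z, flattenGradient g a ρ (⨍⁻ w in ball a (2 * ρ) \ ball a ρ, g w ∂m) z ^ p
      ∂(rieszMeasure m L a b) ≤
      12 ^ p * (1 + 2 * CD) * ∫⁻ z, g z ^ p ∂(rieszMeasure m L a b) := by
  have hp0 : 0 < p := by linarith
  set A := ball a (2 * ρ) \ ball a ρ with hAdef
  have hAm : MeasurableSet A := measurableSet_ball.diff measurableSet_ball
  have hAfin : m A ≠ ⊤ :=
    measure_ne_top_of_subset Set.sdiff_subset (hm.measure_ball_lt_top a (2 * ρ)).ne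
  set α := ⨍⁻ w in A, g w ∂m
  have hgp : Measurable fun z => g z ^ p := hg.pow_const p
  have hR := measurable_riesz hm L a b
  have hRg : Measurable fun w => riesz m L a b w * g w ^ p := hR.mul hgp
  have hpt : ∀ z, flattenGradient g a ρ α z ^ p ≤
      12 ^ p * (g z ^ p + A.indicator (fun _ => α ^ p) z) := by
    intro z
    by_cases hz : z ∈ ball a ρ
    · rw [flattenGradient, Set.indicator_of_notMem (by simpa using hz), ENNReal.zero_rpow_of_pos hp0]
      exact bot_le
    rw [flattenGradient, Set.indicator_of_mem (by simpa using hz)]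
    have he : (ball a (2 * ρ)).indicator (fun _ => α) z ^ p = A.indicator (fun _ => α ^ p) z := by
      by_cases hz2 : z ∈ ball a (2 * ρ)
      · rw [Set.indicator_of_mem hz2, Set.indicator_of_mem (show z ∈ A from ⟨hz2, hz⟩)]
      · rw [Set.indicator_of_notMem hz2, Set.indicator_of_notMem (fun h : z ∈ A => hz2 h.1),
          ENNReal.zero_rpow_of_pos hp0]
    rw [ENNReal.mul_rpow_of_nonneg _ _ hp0.le, ← he]
    calc _ ≤ (6 : ℝ≥0∞) ^ p * (2 ^ (p - 1) *
          (g z ^ p + (ball a (2 * ρ)).indicator (fun _ => α) z ^ p)) := by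
          gcongr
          exact ENNReal.rpow_add_le_mul_rpow_add_rpow _ _ hp
      _ ≤ (6 : ℝ≥0∞) ^ p * (2 ^ p *
          (g z ^ p + (ball a (2 * ρ)).indicator (fun _ => α) z ^ p)) := by
          gcongr
          · norm_num
          · linarith
      _ = _ := by
          rw [← mul_assoc, ← ENNReal.mul_rpow_of_nonneg _ _ hp0.le]
          norm_num
  have hαp : α ^ p ≤ ⨍⁻ w in A, g w ^ p ∂m := laverage_rpow_le hp hA hAfin hg
  have hmain : (∫⁻ z in A, riesz m L a b z ∂m) * α ^ p ≤
      2 * CD * ∫⁻ w, riesz m L a b w * g w ^ p ∂m := by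
    calc _ ≤ (∫⁻ z in A, riesz m L a b z ∂m) * ((∫⁻ w in A, g w ^ p ∂m) / m A) := by
          rw [← setLAverage_eq]
          gcongr
      _ = (∫⁻ w in A, (∫⁻ z in A, riesz m L a b z ∂m) * g w ^ p ∂m) * (m A)⁻¹ := by
          rw [lintegral_const_mul _ hgp, div_eq_mul_inv, mul_assoc]
      _ ≤ (∫⁻ w in A, (2 * CD * m A) * (riesz m L a b w * g w ^ p) ∂m) * (m A)⁻¹ := by
          refine mul_le_mul_left (setLIntegral_mono' hAm fun w hw => ?_) _
          rw [← mul_assoc]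
          refine mul_le_mul_left ?_ _
          calc ∫⁻ z in A, riesz m L a b z ∂m ≤ ∫⁻ z in A, 2 * CD * riesz m L a b w ∂m :=
                setLIntegral_mono' hAm fun z hz => riesz_le_of_mem_annulus hd hCD hL hρ hρd hz hw
            _ = _ := by rw [setLIntegral_const]; ring
      _ = 2 * CD * (∫⁻ w in A, riesz m L a b w * g w ^ p ∂m) * (m A * (m A)⁻¹) := by
          rw [lintegral_const_mul _ hRg]; ring
      _ = 2 * CD * (∫⁻ w in A, riesz m L a b w * g w ^ p ∂m) := by
          rw [ENNReal.mul_inv_cancel hA hAfin, mul_one]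
      _ ≤ _ := mul_le_mul_right (setLIntegral_le_lintegral _ _) _
  have hind : Measurable (A.indicator fun _ : X => α ^ p) := measurable_const.indicator hAm
  have hsum : Measurable fun z => g z ^ p + A.indicator (fun _ => α ^ p) z := hgp.add hind
  calc ∫⁻ z, flattenGradient g a ρ α z ^ p ∂(rieszMeasure m L a b)
      ≤ ∫⁻ z, 12 ^ p * (g z ^ p + A.indicator (fun _ => α ^ p) z) ∂(rieszMeasure m L a b) :=
        lintegral_mono hpt
    _ = 12 ^ p * ((∫⁻ z, g z ^ p ∂(rieszMeasure m L a b)) +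
          ∫⁻ z, A.indicator (fun _ => α ^ p) z ∂(rieszMeasure m L a b)) := by
        rw [lintegral_const_mul _ hsum, lintegral_add_left hgp]
    _ ≤ 12 ^ p * ((∫⁻ z, g z ^ p ∂(rieszMeasure m L a b)) +
          2 * CD * ∫⁻ z, g z ^ p ∂(rieszMeasure m L a b)) := by
        gcongr
        rw [lintegral_indicator_const hAm, rieszMeasure, withDensity_apply _ hAm, mul_comm,
          ← rieszMeasure, lintegral_rieszMeasure hm L a b hgp]
        exact hmain
    _ = _ := by ring

end Flattening

/-! ### (i) ⇒ (ii): flattening at both poles -/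

section PoincareToChain

variable {X : Type u} [MetricSpace X] [MeasurableSpace X] [BorelSpace X] {m : Measure X}
  {CD C : ℝ≥0} {p Λ : ℝ}

theorem measurable_flattenGradient {g : X → ℝ≥0∞} (hg : Measurable g) (a : X) (ρ : ℝ)
    (α : ℝ≥0∞) : Measurable (flattenGradient g a ρ α) :=
  ((hg.add (measurable_const.indicator measurableSet_ball)).const_mul 6).indicator
    measurableSet_ball.compl

theorem IsLebesguePoint.congr {u v : X → ℝ} {b : X} {s : ℝ} (hs : 0 < s)
    (h : IsLebesguePoint m u b) (huv : ∀ w ∈ ball b s, v w = u w) : IsLebesguePoint m v b := by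
  have hev : ∀ᶠ r in 𝓝[>] (0 : ℝ), r < s :=
    mem_nhdsWithin_of_mem_nhds (Iio_mem_nhds hs)
  have hEq : ∀ r < s, Set.EqOn u v (ball b r) := fun r hr w hw =>
    (huv w (ball_subset_ball hr.le hw)).symm
  refine ⟨?_, ?_⟩
  · filter_upwards [h.1, hev] with r hr hrs
    exact hr.congr_fun (hEq r hrs) measurableSet_ball
  · rw [huv b (mem_ball_self hs)]
    refine h.2.congr' ?_
    filter_upwards [hev] with r hrs
    rw [setAverage_eq, setAverage_eq, setIntegral_congr_fun measurableSet_ball (hEq r hrs)]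

theorem exists_flattening (hm : IsMetricMeasureSpace m) (hd : IsDoubling m CD) (hCD : 1 ≤ CD)
    (hconn : ∀ δ > 0, ∀ x y : X, chainDist δ x y ≠ ⊤) {L : ℝ} (hp : 1 ≤ p) (hL : 1 ≤ L)
    {u : X → ℝ} {g : X → ℝ≥0∞} {ε : ℝ} (hε : 0 < ε) (hg : Measurable g)
    (hu : IsLocalGradient ε u g) {a b : X} (hab : a ≠ b) (ha : IsLebesguePoint m u a) {θ : ℝ}
    (hθ : 0 < θ) :
    ∃ (v : X → ℝ) (G : X → ℝ≥0∞) (ρ : ℝ), 0 < ρ ∧ 2 * ρ ≤ dist a b / 4 ∧ Measurable G ∧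
      IsLocalGradient ρ v G ∧ (∀ w ∈ ball a ρ, v w = v a ∧ G w = 0) ∧
      (∀ w, 2 * ρ ≤ dist a w → v w = u w ∧ G w ≤ 6 * g w) ∧ |v a - u a| ≤ θ ∧
      ∫⁻ z, G z ^ p ∂(rieszMeasure m L a b) ≤
        12 ^ p * (1 + 2 * CD) * ∫⁻ z, g z ^ p ∂(rieszMeasure m L a b) := by
  have hdist : 0 < dist a b := dist_pos.2 hab
  have hθ' : 0 < θ / (2 * (CD ^ 4 : ℝ≥0)) := by positivity
  have hev : ∀ᶠ r in 𝓝[>] (0 : ℝ), IntegrableOn u (ball a r) m ∧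
      |(⨍ w in ball a r, u w ∂m) - u a| ≤ θ / (2 * (CD ^ 4 : ℝ≥0)) := by
    refine ha.1.and ?_
    filter_upwards [Metric.tendsto_nhds.1 ha.2 _ hθ'] with r hr
    rw [Real.dist_eq] at hr
    exact hr.le
  obtain ⟨s, hs, hsub⟩ := (mem_nhdsGT_iff_exists_Ioo_subset).1 hev
  rw [Set.mem_Ioi] at hs
  -- Both `ρ` and `2 * ρ` are radii with averages near `u a`; `5 * ρ ≤ ε` puts pairs from the
  -- annulus and the `3 * ρ`-ball in the range of the gradient; the last bound keeps the other pole
  -- away.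
  set ρ := min (s / 4) (min (ε / 5) (dist a b / 8)) with hρdef
  have hρ : 0 < ρ := by positivity
  have hρs : ρ ≤ s / 4 := min_le_left _ _
  have hρε : ρ ≤ ε / 5 := (min_le_right _ _).trans (min_le_left _ _)
  have hρd : ρ ≤ dist a b / 8 := (min_le_right _ _).trans (min_le_right _ _)
  have h1 := hsub (show ρ ∈ Set.Ioo 0 s from ⟨hρ, by linarith⟩)
  have h2 := hsub (show 2 * ρ ∈ Set.Ioo 0 s from ⟨by positivity, by linarith⟩)
  obtain ⟨z₀, hz1, hz2⟩ := exists_dist_mem_Ioo_of_chainDist_ne_top hconn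
    (x := a) (y := b) (a := 5 / 4 * ρ) (b := 7 / 4 * ρ) (by positivity) (by linarith) (by linarith)
  have hK := measure_ball_le_annulus hd hρ hz1 hz2
  set A := ball a (2 * ρ) \ ball a ρ with hA
  have hfin := (hm.measure_ball_lt_top a (2 * ρ)).ne
  have hA0 : m A ≠ 0 := by
    intro h0
    rw [h0, mul_zero, nonpos_iff_eq_zero] at hK
    exact (hd.measure_ball_pos hm a (r := 2 * ρ) (by positivity)).ne' hK
  have hAfin : m A ≠ ⊤ := measure_ne_top_of_subset Set.sdiff_subset hfin
  set c := ⨍ w in A, u w ∂m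
  set α := ⨍⁻ w in A, g w ∂m
  have hc : ∀ w, dist a w < 3 * ρ → edist (u w) c ≤ (g w + α) * ENNReal.ofReal (5 * ρ) := by
    intro w hw
    rw [edist_comm]
    calc edist c (u w) ≤ ⨍⁻ z in A, edist (u z) (u w) ∂m :=
          edist_average_le hA0 hAfin (h2.1.mono_set Set.sdiff_subset) _
      _ ≤ ⨍⁻ z in A, ENNReal.ofReal (5 * ρ) * (g w + g z) ∂m := by
          refine laverage_mono (measurableSet_ball.diff measurableSet_ball) fun z hz => ?_
          have h3 : dist z w ≤ 5 * ρ := by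
            linarith [dist_triangle z a w, mem_ball.1 hz.1]
          refine (hu z w (by linarith)).trans ?_
          rw [mul_comm, add_comm, edist_dist]
          gcongr
      _ = _ := by
          rw [laverage_const_mul _ ENNReal.ofReal_ne_top, laverage_const_add hA0 hAfin, mul_comm]
  have hva : flatten u a ρ c a = c := flatten_eq_const hρ (by rwa [dist_self])
  refine ⟨flatten u a ρ c, flattenGradient g a ρ α, ρ, hρ, by linarith,
    measurable_flattenGradient hg a ρ α, isLocalGradient_flatten hρ (by linarith) hu hc,
    fun w hw => ⟨?_, ?_⟩, fun w hw => ⟨flatten_eq_self hρ hw, ?_⟩, ?_,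
    lintegral_flattenGradient_le hm hd hCD hp hL hρ (by linarith) hA0 hg⟩
  · rw [hva]
    exact flatten_eq_const hρ (mem_ball'.1 hw)
  · rw [flattenGradient, Set.indicator_of_notMem (by simpa using hw)]
  · rw [flattenGradient]
    refine (Set.indicator_le_self _ _ w).trans ?_
    rw [Set.indicator_of_notMem (by rw [mem_ball', not_lt]; exact hw), add_zero]
  · rw [hva]
    refine (abs_average_annulus_sub_le (K := CD ^ 4) h2.1 hfin hρ hA0 ?_ h1.2 h2.2).trans ?_
    · rw [ENNReal.coe_pow]; exact hK
    · refine le_of_eq ?_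
      have : ((CD ^ 4 : ℝ≥0) : ℝ) ≠ 0 := by positivity
      field_simp

/-- The extra constants are one factor `12 ^ p * (1 + 2 * CD)` per flattening and `2 ^ p` from `lip
f ≤ 2 * G`. None depends on `θ`, which is sent to zero. -/
theorem LipPoincare.chainPointwise (hP : LipPoincare m p C Λ) (hm : IsMetricMeasureSpace m)
    (hd : IsDoubling m CD) (hCD : 1 ≤ CD) (hp : 1 ≤ p) (hΛ : 1 ≤ Λ) :
    ChainPointwise m p
      ((8 * CD ^ 6 * C) ^ p * (8 * CD ^ 2 * C + 1) ^ p * CD ^ 4 *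
        (2 ^ p * (12 ^ p * (1 + 2 * CD)) ^ 2))
      (2 * ((8 * CD ^ 2 * C : ℝ≥0) : ℝ) + 4) := by
  intro u _ x y hux huy ε hε g hug
  have hp0 : 0 < p := by linarith
  set L := 2 * ((8 * CD ^ 2 * C : ℝ≥0) : ℝ) + 4
  have hL : 1 ≤ L := by
    have : 0 ≤ ((8 * CD ^ 2 * C : ℝ≥0) : ℝ) := NNReal.coe_nonneg _
    linarith
  set K := (8 * CD ^ 6 * C) ^ p * (8 * CD ^ 2 * C + 1) ^ p * CD ^ 4 with hK
  rw [PointwiseEstimate, ofReal_abs_sub_eq_edist]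
  rcases eq_or_ne x y with rfl | hxy
  · rw [edist_self, ENNReal.zero_rpow_of_pos hp0]
    exact bot_le
  have hconn : ∀ δ > 0, ∀ x y : X, chainDist δ x y ≠ ⊤ := fun δ hδ x y => by
    have := edist_ne_top x y
    exact ((hP.chainDist_le hm hd hCD hp hδ x y).trans_lt (by finiteness)).ne
  set I := ∫⁻ z, g z ^ p ∂(rieszMeasure m L x y)
  set J : ℝ≥0∞ := K * edist x y ^ (p - 1) * (2 ^ p * ((12 ^ p * (1 + 2 * CD)) ^ 2 * I)) with hJ
  have hmain : edist (u x) (u y) ≤ J ^ (1 / p) := by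
    refine ENNReal.le_of_forall_pos_le_add fun θ hθ _ => ?_
    have hθ2 : (0 : ℝ) < θ / 2 := by positivity
    obtain ⟨v, G, ρ, hρ, hρd, hG, hv, hvx, hvo, hvθ, hvI⟩ := exists_flattening hm hd hCD hconn hp hL
      hε hug.1 (fun z w hzw => hug.edist_le hzw) hxy hux hθ2
    have hd0 : 0 < dist x y := dist_pos.2 hxy
    have hnear : ∀ w ∈ ball y (dist x y / 2), v w = u w := by
      intro w hw
      rw [mem_ball] at hw
      exact (hvo w (by linarith [dist_triangle x w y])).1
    have hvy : IsLebesguePoint m v y := huy.congr (by positivity) hnear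
    -- The second flattening starts from the first, now with scale `ρ` in place of `ε`. The first
    -- one left a neighbourhood of `y` unchanged, so `y` is still a Lebesgue point.
    obtain ⟨v', G', ρ', hρ', hρd', hG', hv', hvy', hvo', hvθ', hvI'⟩ := exists_flattening hm hd hCD
      hconn hp hL hρ hG hv hxy.symm hvy hθ2
    rw [dist_comm y x] at hρd'
    have hfar : ∀ w ∈ ball x (min ρ ρ'), v' w = v w ∧ G' w ≤ 6 * G w := by
      intro w hw
      have h1 := (mem_ball.1 hw).trans_le (min_le_left _ _)
      refine hvo' w ?_
      have h2 := dist_triangle y w x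
      rw [dist_comm y x] at h2
      linarith
    have hv'x : v' x = v x := (hfar x (mem_ball_self (lt_min hρ hρ'))).1
    have hest := hP.edist_rpow_le_of_isLocalGradient hm hd hCD hp hΛ hρ' (lt_min hρ hρ') hG' hv' hxy
      (fun w hw => by
        have h1 := hfar w hw
        have h2 := hvx w (ball_subset_ball (min_le_left _ _) hw)
        refine ⟨by rw [h1.1, h2.1, hv'x], ?_⟩
        have h3 := h1.2
        rw [h2.2, mul_zero] at h3
        exact le_antisymm h3 bot_le)
      (fun w hw => hvy' w (ball_subset_ball (min_le_right _ _) hw))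
    have hvxy : edist (v' x) (v' y) ≤ J ^ (1 / p) := by
      rw [one_div, ENNReal.le_rpow_inv_iff hp0]
      refine hest.trans ?_
      rw [hJ]
      gcongr
      rw [rieszMeasure_comm]
      refine hvI'.trans ?_
      rw [rieszMeasure_comm]
      calc _ ≤ 12 ^ p * (1 + 2 * (CD : ℝ≥0∞)) * (12 ^ p * (1 + 2 * CD) * I) := by gcongr
        _ = _ := by ring
    have hx' : edist (u x) (v' x) ≤ ENNReal.ofReal (θ / 2) := by
      rw [hv'x, edist_comm, edist_dist, Real.dist_eq]
      exact ENNReal.ofReal_le_ofReal hvθ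
    have hy' : edist (v' y) (u y) ≤ ENNReal.ofReal (θ / 2) := by
      rw [← hnear y (mem_ball_self (by positivity)), edist_dist, Real.dist_eq]
      exact ENNReal.ofReal_le_ofReal hvθ'
    calc edist (u x) (u y) ≤ edist (u x) (v' x) + edist (v' x) (v' y) + edist (v' y) (u y) :=
          edist_triangle4 _ _ _ _
      _ ≤ ENNReal.ofReal (θ / 2) + J ^ (1 / p) + ENNReal.ofReal (θ / 2) := by gcongr
      _ = J ^ (1 / p) + (ENNReal.ofReal (θ / 2) + ENNReal.ofReal (θ / 2)) := by ring
      _ = J ^ (1 / p) + θ := by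
          rw [← ENNReal.ofReal_add hθ2.le hθ2.le, add_halves, ENNReal.ofReal_coe_nnreal]
  rw [one_div, ENNReal.le_rpow_inv_iff hp0] at hmain
  refine hmain.trans (le_of_eq ?_)
  rw [hJ]
  push_cast
  rw [ENNReal.coe_rpow_of_nonneg _ hp0.le, ENNReal.coe_rpow_of_nonneg _ hp0.le]
  push_cast
  ring

end PoincareToChain

end ChainPI

theorem mainTheorem9 (p : ℝ) (hp : 1 ≤ p) (CD : ℝ≥0) (hCD : 1 ≤ CD) :
    (∀ (C : ℝ≥0) (Λ : ℝ), 1 ≤ C → 1 ≤ Λ →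
      ∃ (C' : ℝ≥0) (L' : ℝ), 0 < C' ∧ 1 ≤ L' ∧
        ∀ (X : Type u) [MetricSpace X] [MeasurableSpace X] [BorelSpace X] (m : Measure X),
          ChainPI.IsMetricMeasureSpace m → ChainPI.IsDoubling m CD →
            ChainPI.LipPoincare m p C Λ → ChainPI.ChainPointwise m p C' L') ∧
    (∀ (C : ℝ≥0) (L : ℝ), 0 < C → 1 ≤ L →
      ∃ (C' : ℝ≥0) (L' : ℝ), 0 < C' ∧ 1 ≤ L' ∧
        ∀ (X : Type u) [MetricSpace X] [MeasurableSpace X] [BorelSpace X] (m : Measure X),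
          ChainPI.IsMetricMeasureSpace m → ChainPI.IsDoubling m CD →
            ChainPI.ChainPointwise m p C L → ChainPI.LipPointwise m p C' L') ∧
    (∀ (C : ℝ≥0) (L : ℝ), 0 < C → 1 ≤ L →
      ∃ (C' : ℝ≥0) (Λ' : ℝ), 1 ≤ C' ∧ 1 ≤ Λ' ∧
        ∀ (X : Type u) [MetricSpace X] [MeasurableSpace X] [BorelSpace X] (m : Measure X),
          ChainPI.IsMetricMeasureSpace m → ChainPI.IsDoubling m CD →
            ChainPI.LipPointwise m p C L → ChainPI.LipPoincare m p C' Λ') := by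
  refine ⟨fun C Λ hC hΛ => ?_, fun C L hC hL => ?_, fun C L hC hL => ?_⟩
  -- Unification reads the constants off the lemma; being chosen outside the quantifier over spaces,
  -- they cannot depend on the space.
  · refine ⟨_, _, ?_, ?_, fun X _ _ _ m hm hd hP => hP.chainPointwise hm hd hCD hp hΛ⟩
    · have h1 : 0 < 8 * CD ^ 6 * C := by positivity
      have h2 : 0 < (8 * CD ^ 6 * C) ^ p := NNReal.rpow_pos h1
      have h3 : 0 < (8 * CD ^ 2 * C + 1) ^ p := NNReal.rpow_pos (by positivity)
      have h4 : 0 < (2 : ℝ≥0) ^ p := NNReal.rpow_pos (by norm_num)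
      have h5 : 0 < (12 : ℝ≥0) ^ p := NNReal.rpow_pos (by norm_num)
      positivity
    · have : 0 ≤ ((8 * CD ^ 2 * C : ℝ≥0) : ℝ) := NNReal.coe_nonneg _
      linarith
  · exact ⟨C, L, hC, hL, fun X _ _ _ m hm hd h => h.lipPointwise hm hd hp⟩
  · refine ⟨_, _, ?_, ?_, fun X _ _ _ m hm hd h => h.lipPoincare hm hd hCD hp hL⟩
    · exact le_self_add
    · linarith
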